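/- Let $X=(X(t))_{t\ge 0}$ be a real-valued Lévy process with $\mathbb E X(1)=0$, $\mathbb E X(1)^2=1$, $\mathbb E X(1)^4<\infty$, and let $k\ge 1$ be an integer. Let $U,U_1,\dots,U_k$ be uniform on $[0,1]$, let $b$ be a standard Brownian bridge on $[0,1]$ and $\beta_1,\dots,\beta_k$ Brownian bridges on $[0,1/k]$, where $X,U,U_1,\dots,U_k,b,\beta_1,\dots,\beta_k$ are defined on one probability space and mutually independent. Write $\Delta_i^kY=Y(\tfrac ik)-Y(\tfrac{i-1}k)$ for $1\le i\le k$. Reordering. Let $h:\mathbb R^2\to\mathbb R$ be any measurable function such that $h(X(1),U)$ is standard normal, and put $W'(t)=b(t)+t\,h(X(1),U)$, $t\in[0,1]$. Almost surely there is exactly one permutation $\pi$ of $\{1,\dots,k\}$ such that for all $i\ne j$ $$\Delta^k_{\pi(i)}W'<\Delta^k_{\pi(j)}W'\iff \Delta_i^kX<\Delta_j^kX\ \text{ or }\ (\Delta_i^kX=\Delta_j^kX\text{ and }U_i<U_j).$$ For any random permutation $\pi$ that almost surely has this property, let $W(0)=0$ and $$W(t)=W(\tfrac{i-1}k)+W'\big(\tfrac{\pi(i)-1}k+t-\tfrac{i-1}k\big)-W'\big(\tfrac{\pi(i)-1}k\big),\qquad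 \tfrac{i-1}k<t\le\tfrac ik,\ 1\le i\le k.$$ Comonotone increments. Let $\xi_i=h_k(\Delta_i^kX,U_i)$, where $$h_k(x,u)=F^{-1}\big(\mathbb P(X(1/k)<x)+u\,\mathbb P(X(1/k)=x)\big),\qquad F^{-1}(v)=\inf\{x: F(x)\ge v\},$$ and $F$ is the distribution function of the normal law with mean $0$ and variance $1/k$. Let $\widehat W(0)=0$ and $$\widehat W(t)=\widehat W(\tfrac{i-1}k)+\beta_i(t-\tfrac{i-1}k)+k(t-\tfrac{i-1}k)\xi_i,\qquad \tfrac{i-1}k<t\le\tfrac ik,\ 1\le i\le k.$$ Then $W$ and $\widehat W$ are standard Brownian motions on $[0,1]$, and with probability $1$, for all $i,j\in\{1,\dots,k\}$, $$\Delta_i^kW<\Delta_j^kW\iff\Delta_i^k\widehat W<\Delta_j^k\widehat W .$$ -/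

import Mathlib

open MeasureTheory ProbabilityTheory Set Filter Topology
open scoped NNReal ENNReal

namespace LevyCoupling

noncomputable section

variable {Ω : Type*} [MeasurableSpace Ω]

/-- `B` is a standard Brownian motion on the time interval `[0, T]`: its finite-dimensional laws at
times in `[0, T]` are those of Brownian motion (Mathlib's `BrownianReal.projectiveFamily`), and its
paths are almost surely continuous on `[0, T]`.  Nothing is said about times after `T`. -/
structure IsBrownianMotionOn (T : ℝ≥0) (B : ℝ≥0 → Ω → ℝ) (P : Measure Ω) : Prop where
  hasLaw : ∀ I : Finset ℝ≥0, (∀ t ∈ I, t ≤ T) →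
    HasLaw (fun ω ↦ I.restrict (B · ω)) (BrownianReal.projectiveFamily I) P
  continuousOn : ∀ᵐ ω ∂P, ContinuousOn (B · ω) (Iic T)

/-- `b` is a (standard) Brownian bridge on `[0, T]`, from `0` to `0`: a centred Gaussian process
with covariance `s - s t / T` for `s ≤ t ≤ T`, with almost surely continuous paths. -/
structure IsBrownianBridgeOn (T : ℝ≥0) (b : ℝ≥0 → Ω → ℝ) (P : Measure Ω) : Prop where
  measurable : ∀ t ≤ T, Measurable (b t)
  isGaussianProcess : IsGaussianProcess (fun t : Iic T ↦ b t) P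
  integral_eq : ∀ t ≤ T, P[b t] = 0
  covariance_eq : ∀ s t, s ≤ t → t ≤ T → cov[b s, b t; P] = (s : ℝ) - s * t / T
  continuousOn : ∀ᵐ ω ∂P, ContinuousOn (b · ω) (Iic T)

/-- `X = (X t, t ≥ 0)` is a real-valued Lévy process. -/
structure IsLevyProcess (X : ℝ≥0 → Ω → ℝ) (P : Measure Ω) : Prop where
  measurable : ∀ t, Measurable (X t)
  zero : ∀ᵐ ω ∂P, X 0 ω = 0
  indepIncrements : HasIndepIncrements X P
  stationaryIncrements : ∀ s t, IdentDistrib (fun ω ↦ X (s + t) ω - X s ω) (X t) P P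
  cadlag : ∀ᵐ ω ∂P, ∀ t, ContinuousWithinAt (X · ω) (Ici t) t ∧
    ∃ l, Tendsto (X · ω) (𝓝[<] t) (𝓝 l)

/-- `V` is a measurable random variable with the uniform law on `[0, 1]`. -/
def IsStandardUniform (V : Ω → ℝ) (P : Measure Ω) : Prop :=
  Measurable V ∧ P.map V = (volume : Measure ℝ).restrict (Icc 0 1)

/-- The σ-algebra generated by the variables `Y t`, `t ∈ s`. -/
abbrev pathSigma {Ω : Type*} (s : Set ℝ≥0) (Y : ℝ≥0 → Ω → ℝ) : MeasurableSpace Ω :=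
  ⨆ t ∈ s, MeasurableSpace.comap (Y t) inferInstance

/-- Labels of the independent sources of randomness. -/
inductive Source (k : ℕ) : Type
  /-- the process `X` -/
  | process
  /-- the uniform `U` used for the end point -/
  | endUniform
  /-- the bridge on `[0, 1]` -/
  | mainBridge
  /-- the uniforms `U₁, …, U_k` -/
  | gridUniform (i : Fin k)
  /-- the bridges `β₁, …, β_k` on `[0, 1/k]` -/
  | gridBridge (i : Fin k)

/-- The σ-algebra generated by each source of randomness. -/
abbrev sourceSigma {Ω : Type*} (k : ℕ) (X : ℝ≥0 → Ω → ℝ) (U : Ω → ℝ) (b : ℝ≥0 → Ω → ℝ)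
    (V : Fin k → Ω → ℝ) (β : Fin k → ℝ≥0 → Ω → ℝ) : Source k → MeasurableSpace Ω
  | .process => pathSigma univ X
  | .endUniform => MeasurableSpace.comap U inferInstance
  | .mainBridge => pathSigma (Iic 1) b
  | .gridUniform i => MeasurableSpace.comap (V i) inferInstance
  | .gridBridge i => pathSigma (Iic (1 / (k : ℝ≥0))) (β i)

/-- The grid point `i / k`. -/
def gridPt (k i : ℕ) : ℝ≥0 := (i : ℝ≥0) / k

/-- The `i`-th increment of a path `y` over the grid `0, 1/k, …, 1`.  Indices start at `0`, so this
is `y ((i+1)/k) - y (i/k)`. -/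
def incr (k : ℕ) (y : ℝ≥0 → ℝ) (i : Fin k) : ℝ := y (gridPt k (i + 1)) - y (gridPt k i)

/-- The left inverse `u ↦ inf {x | F x ≥ u}` of the distribution function `F` of `μ`. -/
def leftInv (μ : Measure ℝ) (u : ℝ) : ℝ := sInf {x | u ≤ cdf μ x}

/-- The function `h` realising the comonotonic coupling of laws `μ₁` and `μ₂`:
`h(x, u) = F₂⁻¹ (μ₁ (-∞, x) + u μ₁ {x})`. -/
def comonotone (μ₁ μ₂ : Measure ℝ) (x u : ℝ) : ℝ :=
  leftInv μ₂ (μ₁.real (Iio x) + u * μ₁.real {x})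

/-- The path on `[0, 1]` that starts at `0` and is obtained by concatenating the `k` path segments
`seg 0, …, seg (k-1)`, each of which runs over the local time interval `[0, 1/k]`.
See `concat_zero` and `concat_eq` for the recursive description. -/
def concat (k : ℕ) (seg : Fin k → ℝ≥0 → ℝ) (t : ℝ≥0) : ℝ :=
  ∑ i : Fin k, if gridPt k i < t then seg i (min (t - gridPt k i) (1 / (k : ℝ≥0))) else 0

theorem concat_zero (k : ℕ) (seg : Fin k → ℝ≥0 → ℝ) : concat k seg 0 = 0 := by
  simp [concat]

theorem gridPt_succ (k i : ℕ) : gridPt k (i + 1) = gridPt k i + 1 / (k : ℝ≥0) := by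
  simp [gridPt, add_div]

theorem gridPt_lt_gridPt {k i j : ℕ} (hk : 0 < k) : gridPt k i < gridPt k j ↔ i < j := by
  have : (0 : ℝ≥0) < k := by exact_mod_cast hk
  simp [gridPt, div_lt_div_iff_of_pos_right this]

/-- On `(i/k, (i+1)/k]` the concatenated path is its value at `i/k` plus the `i`-th segment. -/
theorem concat_eq (k : ℕ) (seg : Fin k → ℝ≥0 → ℝ) (i : Fin k) (t : ℝ≥0)
    (h₁ : gridPt k i < t) (h₂ : t ≤ gridPt k (i + 1)) :
    concat k seg t = concat k seg (gridPt k i) + seg i (t - gridPt k i) := by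
  have hk : 0 < k := i.pos
  have hmono : ∀ a b : ℕ, a ≤ b → gridPt k a ≤ gridPt k b := fun a b hab ↦ by
    rw [← not_lt, gridPt_lt_gridPt hk]; omega
  unfold concat
  rw [← Finset.add_sum_erase _ _ (Finset.mem_univ i),
    ← Finset.add_sum_erase (a := i) (f := fun j : Fin k ↦ if gridPt k j < gridPt k i then _ else _)
      _ (Finset.mem_univ i), if_pos h₁, if_neg (lt_irrefl _), zero_add, add_comm]
  have hi : min (t - gridPt k i) (1 / (k : ℝ≥0)) = t - gridPt k i := by
    rw [min_eq_left]
    rw [tsub_le_iff_left, ← gridPt_succ]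
    exact h₂
  rw [hi]
  congr 1
  refine Finset.sum_congr rfl fun j hj ↦ ?_
  have hji : (j : ℕ) ≠ i := fun h ↦ (Finset.ne_of_mem_erase hj) (Fin.ext h)
  rcases lt_or_gt_of_ne hji with h | h
  · have h3 : gridPt k j < gridPt k i := (gridPt_lt_gridPt hk).2 h
    have h4 : gridPt k j + 1 / (k : ℝ≥0) ≤ gridPt k i := by
      rw [← gridPt_succ]; exact hmono _ _ h
    rw [if_pos h3, if_pos (h3.trans h₁), min_eq_right, min_eq_right]
    · exact le_tsub_of_add_le_left h4
    · exact le_tsub_of_add_le_left (h4.trans h₁.le)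
  · have h3 : ¬ gridPt k j < t := not_lt.2 (h₂.trans (hmono _ _ h))
    have h4 : ¬ gridPt k j < gridPt k i := not_lt.2 (hmono _ _ h.le)
    rw [if_neg h3, if_neg h4]

/-- `W'`: the Brownian motion on `[0, 1]` with bridge `b` and end point `h (X 1) U`. -/
def preBM {Ω : Type*} (h : ℝ → ℝ → ℝ) (X : ℝ≥0 → Ω → ℝ) (U : Ω → ℝ) (b : ℝ≥0 → Ω → ℝ)
    (t : ℝ≥0) (ω : Ω) : ℝ :=
  b t ω + t * h (X 1 ω) (U ω)

/-- `σ` is a permutation matching the ordering of the grid increments of the path `w'` with that of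
the grid increments of the path `x`, where ties of the latter are resolved by the numbers `u i`. -/
def IsMatching (k : ℕ) (x w' : ℝ≥0 → ℝ) (u : Fin k → ℝ) (σ : Equiv.Perm (Fin k)) : Prop :=
  ∀ i j, i ≠ j → (incr k w' (σ i) < incr k w' (σ j) ↔
    incr k x i < incr k x j ∨ (incr k x i = incr k x j ∧ u i < u j))

/-- `W`: the process obtained from `W'` by reordering its pieces over the grid intervals according
to the random permutation `π`. -/
def reorderedBM {Ω : Type*} (k : ℕ) (W' : ℝ≥0 → Ω → ℝ) (π : Ω → Equiv.Perm (Fin k))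
    (t : ℝ≥0) (ω : Ω) : ℝ :=
  concat k (fun i s ↦ W' (gridPt k (π ω i) + s) ω - W' (gridPt k (π ω i)) ω) t

/-- `ξ_i = h_k (Δ_i X, U_i)`: centred normal variables of variance `1/k`, comonotonically coupled
with the grid increments of `X`. -/
def coupledIncr (k : ℕ) (P : Measure Ω) (X : ℝ≥0 → Ω → ℝ) (V : Fin k → Ω → ℝ)
    (i : Fin k) (ω : Ω) : ℝ :=
  comonotone (P.map (X (1 / (k : ℝ≥0)))) (gaussianReal 0 (1 / (k : ℝ≥0)))
    (incr k (X · ω) i) (V i ω)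

/-- `Ŵ`: the process with grid increments `ξ_i` and bridges `β_i` in between. -/
def comonotoneBM (k : ℕ) (P : Measure Ω) (X : ℝ≥0 → Ω → ℝ) (V : Fin k → Ω → ℝ)
    (β : Fin k → ℝ≥0 → Ω → ℝ) (t : ℝ≥0) (ω : Ω) : ℝ :=
  concat k (fun i s ↦ β i s ω + k * s * coupledIncr k P X V i ω) t

end

end LevyCoupling

namespace LevyCoupling

/-! Put `Z i = (Δ_i X, U_i)`. These pairs are i.i.d., and almost surely distinct because the `U_i`
are. The path `W'` is a bridge plus an independent Gaussian drift, hence Brownian motion on `[0,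
1]`. It depends on `Z` only through `X(1) = ∑ Δ_i X`, a symmetric function, and otherwise on `(U,
b)`, which is independent of `Z`.

Permuting `Z` by `τ` changes neither the law of `(Z, U, b)` nor `W'`, but it turns a matching
permutation `σ` into `σ * τ`. So all values of the matching permutation are equally likely, even
given `W'`: it is uniform and independent of `W'` (`card_mul_measure_matches`). A fixed permutation
of the pieces preserves Brownian motion (`IsPreBrownianOn.reorder`), so an independent uniform one
does too (`isBrownianMotionOn_reorderedBM`).

For `Ŵ`, the randomized rank of `Z i` is uniform, so the `ξ_i` are independent normal variables of
variance `1/k` (`hasLaw_comonotone`). Adding `β_i` gives independent Brownian segments, and their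
concatenation is Brownian motion.

Finally `Δ_i W = Δ_{π(i)} W'` is ordered like `Z i` lexicographically by the choice of `π`. So is
`Δ_i Ŵ = ξ_i`, a monotone function of `Z i` without ties (`ae_coupledIncr_lt_iff`). -/

/-- `B` is a centred Gaussian process on `[0, T]` with the covariance of Brownian motion. -/
structure IsPreBrownianOn {Ω : Type*} [MeasurableSpace Ω] (T : ℝ≥0) (B : ℝ≥0 → Ω → ℝ)
    (P : Measure Ω) : Prop where
  isGaussianProcess : IsGaussianProcess (fun t : Iic T ↦ B t) P
  integral_eq : ∀ t ≤ T, P[B t] = 0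
  covariance_eq : ∀ s t, s ≤ t → t ≤ T → cov[B s, B t; P] = (s : ℝ)

/-! ### Gaussian processes, Brownian motion and bridges through means and covariances. -/

section Gaussian

variable {Ω : Type*} [MeasurableSpace Ω] {P : Measure Ω}

/-- Finite linear combinations of the variables of a Gaussian process form a Gaussian process. -/
theorem isGaussianProcess_of_eq_sum {S R ι : Type*} [Fintype ι] {X : S → Ω → ℝ}
    (hX : IsGaussianProcess X P) {Y : R → Ω → ℝ} (c : R → ι → ℝ) (f : R → ι → S)
    (h : ∀ r ω, Y r ω = ∑ i, c r i * X (f r i) ω) : IsGaussianProcess Y P := by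
  classical
  refine hX.of_isGaussianProcess fun r ↦ ⟨Finset.univ.image (f r),
    ∑ i, c r i • ContinuousLinearMap.proj (R := ℝ)
      (⟨f r i, Finset.mem_image_of_mem _ (Finset.mem_univ i)⟩ : Finset.univ.image (f r)),
    fun ω ↦ ?_⟩
  rw [h]
  simp [Finset.restrict]

/-- Independent Gaussian processes are jointly Gaussian. -/
theorem isGaussianProcess_of_iIndepFun {ι S : Type*} [Finite ι] {X : ι → S → Ω → ℝ}
    (hX : ∀ i, IsGaussianProcess (X i) P) (hindep : iIndepFun (fun i ω s ↦ X i s ω) P) :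
    IsGaussianProcess (fun p : ι × S ↦ X p.1 p.2) P where
  hasGaussianLaw I := by
    classical
    let := Fintype.ofFinite ι
    -- Enlarge `I` to the rectangle `ι × J`: independence gives a joint Gaussian law there, and `I`
    -- is a linear projection of it.
    let J : Finset S := I.image Prod.snd
    have h1 : ∀ i, HasGaussianLaw (fun ω (s : J) ↦ X i s ω) P := fun i ↦ (hX i).hasGaussianLaw J
    have h2 : iIndepFun (fun i ω (s : J) ↦ X i s ω) P :=
      hindep.comp (fun _ x (s : J) ↦ x s) fun _ ↦ by fun_prop
    have h3 := h2.hasGaussianLaw h1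
    let L : (ι → J → ℝ) →L[ℝ] (I → ℝ) := ContinuousLinearMap.pi fun p ↦
      (ContinuousLinearMap.proj (R := ℝ) (φ := fun _ : J ↦ ℝ)
        ⟨p.1.2, Finset.mem_image_of_mem _ p.2⟩).comp
      (ContinuousLinearMap.proj (R := ℝ) (φ := fun _ : ι ↦ J → ℝ) p.1.1)
    exact h3.map L

theorem isGaussianProcess_memLp {S : Type*} {X : S → Ω → ℝ} (hX : IsGaussianProcess X P) (s : S) :
    MemLp (X s) 2 P := (hX.hasGaussianLaw_eval s).memLp_two

theorem IsPreBrownianOn.memLp {T : ℝ≥0} {B : ℝ≥0 → Ω → ℝ} (hB : IsPreBrownianOn T B P)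
    {t : ℝ≥0} (ht : t ≤ T) : MemLp (B t) 2 P :=
  isGaussianProcess_memLp hB.isGaussianProcess ⟨t, ht⟩

theorem IsPreBrownianOn.covariance_eq_min {T : ℝ≥0} {B : ℝ≥0 → Ω → ℝ} (hB : IsPreBrownianOn T B P)
    {s t : ℝ≥0} (hs : s ≤ T) (ht : t ≤ T) : cov[B s, B t; P] = (min s t : ℝ≥0) := by
  rcases le_total s t with h | h
  · rw [hB.covariance_eq s t h ht, min_eq_left h]
  · rw [covariance_comm, hB.covariance_eq t s h hs, min_eq_right h]

/-- A Gaussian law is determined by its mean and covariance. The comparison is made after transport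
to the Euclidean space `PiLp 2`, whose inner product lets `IsGaussian.ext` and `covarianceBilin`
apply. -/
theorem IsPreBrownianOn.hasLaw {T : ℝ≥0} {B : ℝ≥0 → Ω → ℝ} (hB : IsPreBrownianOn T B P)
    (I : Finset ℝ≥0) (hI : ∀ t ∈ I, t ≤ T) :
    HasLaw (fun ω ↦ I.restrict (B · ω)) (BrownianReal.projectiveFamily I) P := by
  let f : I → Iic T := fun t ↦ ⟨t, hI t t.2⟩
  have hG : HasGaussianLaw (fun ω ↦ I.restrict (B · ω)) P := by
    classical
    have h1 := hB.isGaussianProcess.comp_right f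
    exact (h1.hasGaussianLaw Finset.univ).map (ContinuousLinearMap.pi fun t : I ↦
      ContinuousLinearMap.proj (R := ℝ) (φ := fun _ : (Finset.univ : Finset I) ↦ ℝ)
        ⟨t, Finset.mem_univ t⟩)
  have hmeas : ∀ t : I, AEMeasurable (B t) P := fun t ↦ hB.isGaussianProcess.aemeasurable (f t)
  have := hG.isProbabilityMeasure
  have hm : AEMeasurable (fun ω ↦ I.restrict (B · ω)) P := aemeasurable_pi_lambda _ hmeas
  refine ⟨hm, ?_⟩
  apply (MeasurableEquiv.toLp 2 (_ → ℝ)).map_measurableEquiv_injective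
  rw [MeasurableEquiv.coe_toLp, ← PiLp.coe_symm_continuousLinearEquiv 2 ℝ]
  have := hG.isGaussian_map
  apply IsGaussian.ext
  · rw [integral_map, integral_map, integral_map]
    · simp only [id_eq]
      rw [ContinuousLinearEquiv.integral_comp_id_comm,
        ContinuousLinearEquiv.integral_comp_comm]
      simp only [PiLp.continuousLinearEquiv_symm_apply, BrownianReal.integral_id_projectiveFamily,
        WithLp.toLp_zero, WithLp.toLp_eq_zero]
      congr with i
      rw [eval_integral]
      · simpa using hB.integral_eq i (hI i i.2)
      · exact fun i ↦ (hB.memLp (hI i i.2)).integrable one_le_two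
    any_goals fun_prop
  · rw [← ContinuousLinearMap.toBilinForm_inj]
    refine LinearMap.BilinForm.ext_of_isSymm isPosSemidef_covarianceBilin.isSymm
      isPosSemidef_covarianceBilin.isSymm fun x ↦ ?_
    simp only [ContinuousLinearMap.toBilinForm_apply]
    rw [PiLp.coe_symm_continuousLinearEquiv, covarianceBilin_apply_pi, covarianceBilin_apply_pi]
    · congrm ∑ i, ∑ j, _ * ?_
      rw [BrownianReal.covariance_eval_projectiveFamily, covariance_map]
      · exact hB.covariance_eq_min (hI i i.2) (hI j j.2)
      any_goals exact Measurable.aestronglyMeasurable (by fun_prop)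
      exact hm
    · exact fun i ↦ (IsGaussian.hasGaussianLaw_id.eval i).memLp_two
    · exact fun i ↦ (hG.isGaussian_map.hasGaussianLaw_id.eval i).memLp_two

theorem IsPreBrownianOn.congr {T : ℝ≥0} {B C : ℝ≥0 → Ω → ℝ} (hB : IsPreBrownianOn T B P)
    (h : ∀ t ≤ T, B t =ᵐ[P] C t) : IsPreBrownianOn T C P where
  isGaussianProcess := hB.isGaussianProcess.congr fun t ↦ h t t.2
  integral_eq t ht := by rw [← hB.integral_eq t ht]; exact (integral_congr_ae (h t ht)).symm
  covariance_eq s t hst ht := by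
    rw [← hB.covariance_eq s t hst ht]
    have hs := h s (hst.trans ht)
    unfold covariance
    rw [integral_congr_ae hs, integral_congr_ae (h t ht)]
    refine integral_congr_ae ?_
    filter_upwards [hs, h t ht] with ω h1 h2
    rw [h1, h2]

/-- A Brownian bridge plus an independent linear Gaussian drift is Brownian motion. -/
theorem IsBrownianBridgeOn.isPreBrownianOn_add {T : ℝ≥0} (hT : 0 < T) {b : ℝ≥0 → Ω → ℝ}
    (hb : IsBrownianBridgeOn T b P) {ξ : Ω → ℝ} (hξ : HasLaw ξ (gaussianReal 0 T) P)
    (hindep : IndepFun (fun ω (t : Iic T) ↦ b t ω) ξ P) :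
    IsPreBrownianOn T (fun t ω ↦ b t ω + (t / T : ℝ) * ξ ω) P := by
  have hξG : HasGaussianLaw ξ P := hξ.hasGaussianLaw
  have hP : IsProbabilityMeasure P := hξG.isProbabilityMeasure
  have hbL : ∀ t ≤ T, MemLp (b t) 2 P := fun t ht ↦
    isGaussianProcess_memLp hb.isGaussianProcess ⟨t, ht⟩
  have hξL : MemLp ξ 2 P := hξG.memLp_two
  have hcov : ∀ t ≤ T, cov[b t, ξ; P] = 0 := fun t ht ↦
    IndepFun.covariance_eq_zero (hindep.comp (φ := fun x : Iic T → ℝ ↦ x ⟨t, ht⟩)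
      (measurable_pi_apply _) measurable_id)
      (hbL t ht) hξL
  have hvar : cov[ξ, ξ; P] = T := by
    rw [covariance_self hξL.aemeasurable, hξ.variance_eq, variance_id_gaussianReal]
  refine ⟨⟨fun I ↦ ?_⟩, fun t ht ↦ ?_, fun s t hst ht ↦ ?_⟩
  · have h1 : IndepFun (fun ω ↦ I.restrict (fun t : Iic T ↦ b t ω)) ξ P :=
      hindep.comp (φ := fun x ↦ I.restrict x) (Finset.measurable_restrict I) measurable_id
    have h2 := h1.hasGaussianLaw (hb.isGaussianProcess.hasGaussianLaw I) hξG
    let L : (I → ℝ) × ℝ →L[ℝ] (I → ℝ) := ContinuousLinearMap.pi fun t ↦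
      (ContinuousLinearMap.proj (R := ℝ) (φ := fun _ : I ↦ ℝ) t).comp
          (ContinuousLinearMap.fst ℝ (I → ℝ) ℝ)
        + (t.1.1 / T : ℝ) • ContinuousLinearMap.snd ℝ (I → ℝ) ℝ
    exact h2.map L
  · have hm : P[ξ] = 0 := by rw [hξ.integral_eq, integral_id_gaussianReal]
    rw [integral_add ((hbL t ht).integrable one_le_two)
      ((hξL.integrable one_le_two).const_mul _), integral_const_mul, hm, hb.integral_eq t ht]
    simp
  · have e : ∀ t : ℝ≥0, (fun ω ↦ b t ω + (t / T : ℝ) * ξ ω) = b t + (t / T : ℝ) • ξ :=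
      fun t ↦ rfl
    have hs := hst.trans ht
    -- The drift contributes `(s/T)(t/T) T = st/T`, exactly what the bridge covariance `s - st/T`
    -- lacks.
    rw [e, e, covariance_add_left (hbL s hs) (hξL.const_smul _)
        ((hbL t ht).add (hξL.const_smul _)),
      covariance_add_right (hbL s hs) (hbL t ht) (hξL.const_smul _),
      covariance_add_right (hξL.const_smul _) (hbL t ht) (hξL.const_smul _),
      covariance_smul_right, covariance_smul_left, covariance_smul_left, covariance_smul_right,
      covariance_comm ξ (b t), hcov s hs, hcov t ht, hvar, hb.covariance_eq s t hst ht]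
    have : (T : ℝ) ≠ 0 := by exact_mod_cast hT.ne'
    field_simp
    ring

/-- The hypothesis `h` says that the variance at `t` vanishes; it serves for `t = 0` and `t = T`. -/
theorem IsBrownianBridgeOn.ae_eq_zero [IsProbabilityMeasure P] {T : ℝ≥0} {b : ℝ≥0 → Ω → ℝ}
    (hb : IsBrownianBridgeOn T b P) {t : ℝ≥0} (ht : t ≤ T) (h : (t : ℝ) - t * t / T = 0) :
    ∀ᵐ ω ∂P, b t ω = 0 := by
  have hL : MemLp (b t) 2 P := isGaussianProcess_memLp hb.isGaussianProcess ⟨t, ht⟩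
  have h1 := hb.covariance_eq t t le_rfl ht
  rw [covariance_self hL.aemeasurable, h] at h1
  have h2 := ae_eq_integral_of_variance_eq_zero hL h1
  rw [hb.integral_eq t ht] at h2
  exact h2

end Gaussian

/-! ### Concatenation, permutation and grid increments of Brownian segments. -/

section Concat

/-- Segments starting at `0` make the case distinction in `concat` redundant; what remains is
visibly continuous in `t`. -/
theorem concat_eq_sum {k : ℕ} {seg : Fin k → ℝ≥0 → ℝ} (h0 : ∀ i, seg i 0 = 0) (t : ℝ≥0) :
    concat k seg t = ∑ i, seg i (min (t - gridPt k i) (1 / (k : ℝ≥0))) := by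
  refine Finset.sum_congr rfl fun i _ ↦ ?_
  split_ifs with h
  · rfl
  · rw [tsub_eq_zero_of_le (not_lt.1 h), min_eq_left zero_le, h0]

theorem continuous_concat {k : ℕ} {seg : Fin k → ℝ≥0 → ℝ} (h0 : ∀ i, seg i 0 = 0)
    (hc : ∀ i, ContinuousOn (seg i) (Iic (1 / (k : ℝ≥0)))) : Continuous (concat k seg) := by
  rw [funext (concat_eq_sum h0)]
  refine continuous_finsetSum _ fun i _ ↦ ?_
  exact (hc i).comp_continuous (by fun_prop) fun t ↦ mem_Iic.2 (min_le_right _ _)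

theorem incr_concat {k : ℕ} (seg : Fin k → ℝ≥0 → ℝ) (i : Fin k) :
    incr k (concat k seg) i = seg i (1 / (k : ℝ≥0)) := by
  have h : gridPt k i < gridPt k (i + 1) := (gridPt_lt_gridPt i.pos).2 (Nat.lt_succ_self _)
  rw [incr, concat_eq k seg i _ h le_rfl, gridPt_succ, add_sub_cancel_left, add_tsub_cancel_left]

theorem gridPt_mono {k i j : ℕ} (h : i ≤ j) : gridPt k i ≤ gridPt k j := by
  unfold gridPt; gcongr

theorem gridPt_self {k : ℕ} (hk : 0 < k) : gridPt k k = 1 := by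
  have : (k : ℝ≥0) ≠ 0 := by exact_mod_cast hk.ne'
  simp [gridPt, this]

theorem gridPt_add_le_one {k : ℕ} (i : Fin k) {s : ℝ≥0} (hs : s ≤ 1 / (k : ℝ≥0)) :
    gridPt k i + s ≤ 1 := by
  rw [← gridPt_self i.pos]
  calc gridPt k i + s ≤ gridPt k i + 1 / (k : ℝ≥0) := by gcongr
    _ = gridPt k (i + 1) := (gridPt_succ k i).symm
    _ ≤ gridPt k k := gridPt_mono i.2

theorem gridPt_le_one {k : ℕ} (i : Fin k) : gridPt k i ≤ 1 := by
  simpa using gridPt_add_le_one i (zero_le : 0 ≤ 1 / (k : ℝ≥0))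

/-- The time spent before `s` in the grid intervals adds up to `s`. -/
theorem sum_min_tsub_gridPt {k : ℕ} (hk : 0 < k) {s : ℝ≥0} (hs : s ≤ 1) :
    ∑ i : Fin k, ((min (s - gridPt k i) (1 / (k : ℝ≥0)) : ℝ≥0) : ℝ) = s := by
  -- As differences of `min s (gridPt k i)`, the summands telescope.
  have h : ∀ i : ℕ, ((min (s - gridPt k i) (1 / (k : ℝ≥0)) : ℝ≥0) : ℝ)
      = (min s (gridPt k (i + 1)) : ℝ≥0) - (min s (gridPt k i) : ℝ≥0) := by
    intro i
    rw [gridPt_succ]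
    rcases le_total s (gridPt k i) with h1 | h1
    · rw [tsub_eq_zero_of_le h1, min_eq_left h1, min_eq_left (h1.trans le_self_add)]
      simp
    · rw [min_eq_right h1]
      rcases le_total s (gridPt k i + 1 / (k : ℝ≥0)) with h2 | h2
      · rw [min_eq_left h2, min_eq_left (tsub_le_iff_left.2 h2), NNReal.coe_sub h1]
      · rw [min_eq_right h2, min_eq_right (le_tsub_of_add_le_left h2), NNReal.coe_add]
        ring
  rw [Fin.sum_univ_eq_sum_range
    (fun i ↦ ((min (s - gridPt k i) (1 / (k : ℝ≥0)) : ℝ≥0) : ℝ)) k]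
  simp_rw [h]
  rw [Finset.sum_range_sub (fun i ↦ ((min s (gridPt k i) : ℝ≥0) : ℝ)), gridPt_self hk,
    min_eq_left hs]
  simp [gridPt]

variable {Ω : Type*} [MeasurableSpace Ω] {P : Measure Ω}

/-- Concatenating uncorrelated jointly Gaussian Brownian segments yields Brownian motion. -/
theorem isPreBrownianOn_concat {k : ℕ} (hk : 0 < k) {S : Fin k → ℝ≥0 → Ω → ℝ}
    (hG : IsGaussianProcess (fun p : Fin k × Iic (1 / (k : ℝ≥0)) ↦ S p.1 p.2) P)
    (hm : ∀ i, ∀ t ≤ 1 / (k : ℝ≥0), P[S i t] = 0)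
    (hc : ∀ i j, ∀ s ≤ 1 / (k : ℝ≥0), ∀ t ≤ 1 / (k : ℝ≥0),
      cov[S i s, S j t; P] = if i = j then ((min s t : ℝ≥0) : ℝ) else 0) :
    IsPreBrownianOn 1 (fun t ω ↦ concat k (fun i s ↦ S i s ω) t) P := by
  have hP := hG.isProbabilityMeasure
  have hL : ∀ i, ∀ t ≤ 1 / (k : ℝ≥0), MemLp (S i t) 2 P := fun i t ht ↦
    isGaussianProcess_memLp hG (i, ⟨t, ht⟩)
  -- `m t i` is the time spent in the `i`-th interval before `t`. The indicator `c` must be kept,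
  -- since `S i 0 = 0` is not assumed pointwise; it is harmless in covariances because `m t i = 0`
  -- whenever `c t i = 0`.
  let c : ℝ≥0 → Fin k → ℝ := fun t i ↦ if gridPt k i < t then 1 else 0
  let m : ℝ≥0 → Fin k → ℝ≥0 := fun t i ↦ min (t - gridPt k i) (1 / (k : ℝ≥0))
  have hmk : ∀ t i, m t i ≤ 1 / (k : ℝ≥0) := fun t i ↦ min_le_right _ _
  have hcm : ∀ t i, c t i * m t i = m t i := by
    intro t i
    by_cases h : gridPt k i < t
    · simp [c, h]
    · simp [c, h, m, tsub_eq_zero_of_le (not_lt.1 h)]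
  have e : ∀ t ω, concat k (fun i s ↦ S i s ω) t = ∑ i, c t i * S i (m t i) ω := by
    intro t ω
    refine Finset.sum_congr rfl fun i _ ↦ ?_
    simp [c, m]
  refine ⟨?_, fun t ht ↦ ?_, fun s t hst ht ↦ ?_⟩
  · exact isGaussianProcess_of_eq_sum hG (fun t : Iic (1 : ℝ≥0) ↦ c t)
      (fun t i ↦ (i, ⟨m t i, hmk t i⟩)) fun t ω ↦ e t ω
  · simp_rw [e]
    rw [integral_finsetSum _ fun i _ ↦ ((hL i _ (hmk t i)).integrable one_le_two).const_mul _]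
    simp_rw [integral_const_mul]
    exact Finset.sum_eq_zero fun i _ ↦ by rw [hm i _ (hmk t i), mul_zero]
  · simp_rw [e]
    rw [covariance_fun_sum_fun_sum (fun i ↦ (hL i _ (hmk s i)).const_mul _)
      (fun i ↦ (hL i _ (hmk t i)).const_mul _)]
    simp_rw [covariance_const_mul_left, covariance_const_mul_right]
    have h1 : ∀ i j, c s i * (c t j * cov[S i (m s i), S j (m t j); P])
        = if i = j then (m s i : ℝ) else 0 := by
      intro i j
      rw [hc i j _ (hmk s i) _ (hmk t j)]
      split_ifs with hij
      · subst hij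
        have hle : m s i ≤ m t i := by simp only [m]; gcongr
        have h2 : c t i * (m s i : ℝ) = m s i := by
          by_cases h : gridPt k i < t
          · simp [c, h]
          · have : m t i = 0 := by simp [m, tsub_eq_zero_of_le (not_lt.1 h)]
            rw [this, nonpos_iff_eq_zero] at hle
            simp [hle]
        rw [min_eq_left hle, h2, hcm]
      · simp
    simp_rw [h1]
    simp only [Finset.sum_ite_eq, Finset.mem_univ, if_true]
    exact sum_min_tsub_gridPt hk (hst.trans ht)

/-- Independent Brownian segments concatenate to Brownian motion. -/
theorem isPreBrownianOn_concat_of_iIndepFun {k : ℕ} (hk : 0 < k) {S : Fin k → ℝ≥0 → Ω → ℝ}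
    (hS : ∀ i, IsPreBrownianOn (1 / (k : ℝ≥0)) (S i) P)
    (hindep : iIndepFun (fun i ω (s : Iic (1 / (k : ℝ≥0))) ↦ S i s ω) P) :
    IsPreBrownianOn 1 (fun t ω ↦ concat k (fun i s ↦ S i s ω) t) P := by
  refine isPreBrownianOn_concat hk
    (isGaussianProcess_of_iIndepFun (X := fun i (s : Iic (1 / (k : ℝ≥0))) ↦ S i s)
      (fun i ↦ IsPreBrownianOn.isGaussianProcess (hS i)) hindep)
    (fun i ↦ (hS i).integral_eq) fun i j s hs t ht ↦ ?_
  split_ifs with hij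
  · subst hij
    exact (hS i).covariance_eq_min hs ht
  · exact IndepFun.covariance_eq_zero ((hindep.indepFun hij).comp
      (φ := fun x : Iic (1 / (k : ℝ≥0)) → ℝ ↦ x ⟨s, hs⟩)
      (ψ := fun x : Iic (1 / (k : ℝ≥0)) → ℝ ↦ x ⟨t, ht⟩)
      (measurable_pi_apply _) (measurable_pi_apply _)) ((hS i).memLp hs) ((hS j).memLp ht)

/-- The covariance of increments of Brownian motion within grid intervals. -/
theorem IsPreBrownianOn.covariance_segment {k : ℕ} {W : ℝ≥0 → Ω → ℝ} (hW : IsPreBrownianOn 1 W P)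
    (i j : Fin k) {s t : ℝ≥0} (hs : s ≤ 1 / (k : ℝ≥0)) (ht : t ≤ 1 / (k : ℝ≥0)) :
    cov[fun ω ↦ W (gridPt k i + s) ω - W (gridPt k i) ω,
      fun ω ↦ W (gridPt k j + t) ω - W (gridPt k j) ω; P]
      = if i = j then ((min s t : ℝ≥0) : ℝ) else 0 := by
  have hP := hW.isGaussianProcess.isProbabilityMeasure
  wlog hij : i ≤ j generalizing i j s t
  · rw [covariance_comm, this j i ht hs (le_of_not_ge hij), min_comm]
    simp [eq_comm]
  have his := gridPt_add_le_one i hs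
  have hjt := gridPt_add_le_one j ht
  have hi := gridPt_le_one i
  have hj := gridPt_le_one j
  rw [covariance_fun_sub_fun_sub (hW.memLp his) (hW.memLp hi) (hW.memLp hjt) (hW.memLp hj),
    hW.covariance_eq_min his hjt, hW.covariance_eq_min his hj, hW.covariance_eq_min hi hjt,
    hW.covariance_eq_min hi hj]
  split_ifs with h
  · subst h
    rw [min_add_add_left, min_eq_right le_self_add, min_eq_left le_self_add, min_self,
      NNReal.coe_add]
    ring
  -- For `i < j` the first interval ends before the second begins, so each minimum is the time
  -- belonging to `i` and the four terms cancel.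
  · have h1 : gridPt k i + s ≤ gridPt k j := by
      calc gridPt k i + s ≤ gridPt k i + 1 / (k : ℝ≥0) := by gcongr
        _ = gridPt k (i + 1) := (gridPt_succ k i).symm
        _ ≤ gridPt k j := gridPt_mono (lt_of_le_of_ne hij h)
    have h2 : gridPt k i ≤ gridPt k j := le_self_add.trans h1
    rw [min_eq_left (h1.trans le_self_add), min_eq_left h1, min_eq_left (h2.trans le_self_add),
      min_eq_left h2]
    ring

/-- Permuting the pieces of Brownian motion over the grid intervals by a fixed permutation. -/
theorem IsPreBrownianOn.reorder {k : ℕ} (hk : 0 < k) {W : ℝ≥0 → Ω → ℝ}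
    (hW : IsPreBrownianOn 1 W P) (σ : Equiv.Perm (Fin k)) :
    IsPreBrownianOn 1 (reorderedBM k W fun _ ↦ σ) P := by
  refine isPreBrownianOn_concat hk
    (S := fun i s ω ↦ W (gridPt k (σ i) + s) ω - W (gridPt k (σ i)) ω) ?_ (fun i t ht ↦ ?_)
    fun i j s hs t ht ↦ ?_
  · refine isGaussianProcess_of_eq_sum (ι := Fin 2) hW.isGaussianProcess (fun _ ↦ ![1, -1])
      (fun p ↦ ![⟨gridPt k (σ p.1) + p.2, gridPt_add_le_one _ p.2.2⟩,
        ⟨gridPt k (σ p.1), gridPt_le_one _⟩]) fun p ω ↦ ?_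
    simp [Fin.sum_univ_two, sub_eq_add_neg]
  · have h1 := gridPt_add_le_one (σ i) ht
    have h2 := gridPt_le_one (σ i)
    have hP := hW.isGaussianProcess.isProbabilityMeasure
    rw [integral_sub ((hW.memLp h1).integrable one_le_two)
      ((hW.memLp h2).integrable one_le_two), hW.integral_eq _ h1, hW.integral_eq _ h2, sub_zero]
  · simpa using hW.covariance_segment (σ i) (σ j) hs ht

/-- Brownian motion almost surely has pairwise distinct increments over the grid. -/
theorem IsPreBrownianOn.ae_injective_incr {k : ℕ} {W : ℝ≥0 → Ω → ℝ}
    (hW : IsPreBrownianOn 1 W P) : ∀ᵐ ω ∂P, Function.Injective (incr k (W · ω)) := by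
  have hP := hW.isGaussianProcess.isProbabilityMeasure
  have key : ∀ i j : Fin k, i ≠ j → ∀ᵐ ω ∂P, incr k (W · ω) i ≠ incr k (W · ω) j := by
    intro i j hij
    have hk : (0 : ℝ) < k := by exact_mod_cast i.pos
    have hle : ∀ i : Fin k, gridPt k (i + 1) ≤ 1 := fun i ↦ by
      rw [gridPt_succ]; exact gridPt_add_le_one i le_rfl
    let D : Ω → ℝ := fun ω ↦ incr k (W · ω) i - incr k (W · ω) j
    -- The difference of two increments is Gaussian with variance `2/k > 0`, so it has no atom at
    -- `0`.
    have hD : HasGaussianLaw D P := by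
      have h : IsGaussianProcess (fun _ : Unit ↦ D) P := by
        refine isGaussianProcess_of_eq_sum (ι := Fin 4) hW.isGaussianProcess
          (fun _ ↦ ![1, -1, -1, 1])
          (fun p ↦ ![⟨gridPt k (i + 1), hle i⟩, ⟨gridPt k i, gridPt_le_one i⟩,
            ⟨gridPt k (j + 1), hle j⟩, ⟨gridPt k j, gridPt_le_one j⟩]) fun p ω ↦ ?_
        simp [D, incr, Fin.sum_univ_four]
        ring
      exact h.hasGaussianLaw_eval ()
    let A : Fin k → Ω → ℝ := fun i ω ↦ W (gridPt k i + 1 / (k : ℝ≥0)) ω - W (gridPt k i) ω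
    have hA : ∀ i, MemLp (A i) 2 P := fun i ↦
      (hW.memLp (gridPt_add_le_one i le_rfl)).sub (hW.memLp (gridPt_le_one i))
    have hDA : D = fun ω ↦ A i ω - A j ω := by
      funext ω; simp only [D, A, incr, gridPt_succ]
    have hvar : Var[D; P] = 2 / k := by
      rw [← covariance_self hD.aemeasurable, hDA,
        covariance_fun_sub_fun_sub (hA i) (hA j) (hA i) (hA j),
        hW.covariance_segment i i le_rfl le_rfl, hW.covariance_segment i j le_rfl le_rfl,
        hW.covariance_segment j i le_rfl le_rfl, hW.covariance_segment j j le_rfl le_rfl]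
      simp [hij, hij.symm]
      ring
    have hna : NullSingletonClass (P.map D) := by
      rw [hD.map_eq_gaussianReal]
      exact nullSingletonClass_gaussianReal (by rw [hvar]; simpa using i.pos)
    have h0 : P (D ⁻¹' {0}) = 0 := by
      rw [← Measure.map_apply_of_aemeasurable hD.aemeasurable (measurableSet_singleton 0)]
      exact measure_singleton 0
    filter_upwards [measure_eq_zero_iff_ae_notMem.1 h0] with ω hω h
    exact hω (by simp [D, h])
  have h2 : ∀ᵐ ω ∂P, ∀ i j : Fin k, i ≠ j → incr k (W · ω) i ≠ incr k (W · ω) j := by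
    simp_rw [ae_all_iff]
    exact key
  filter_upwards [h2] with ω hω i j h
  by_contra hne
  exact hω i j hne h

end Concat

/-! ### Quantile functions and the randomized probability integral transform. -/

section Comonotone

/-- For levels in `(0, 1)` the left inverse of a distribution function is its Galois adjoint. -/
theorem leftInv_le_iff (μ : Measure ℝ) {c : ℝ} (h0 : 0 < c) (h1 : c < 1) (x : ℝ) :
    leftInv μ c ≤ x ↔ c ≤ cdf μ x := by
  have hne : {x | c ≤ cdf μ x}.Nonempty :=
    (((tendsto_cdf_atTop μ).eventually (lt_mem_nhds h1)).exists).imp fun _ h ↦ h.le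
  have hbdd : BddBelow {x | c ≤ cdf μ x} := by
    obtain ⟨y, hy⟩ := ((tendsto_cdf_atBot μ).eventually (gt_mem_nhds h0)).exists
    exact ⟨y, fun z hz ↦ le_of_not_gt fun hzy ↦
      absurd (hz.trans (monotone_cdf μ hzy.le)) (not_le.2 hy)⟩
  refine ⟨fun h ↦ ?_, fun h ↦ csInf_le hbdd h⟩
  refine le_trans ?_ (monotone_cdf μ h)
  -- Right continuity of the distribution function shows that the infimum is attained.
  have ht : Tendsto (cdf μ) (𝓝[>] (leftInv μ c)) (𝓝 (cdf μ (leftInv μ c))) :=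
    ((cdf μ).right_continuous _).mono_left (nhdsWithin_mono _ Ioi_subset_Ici_self)
  refine ge_of_tendsto ht ?_
  filter_upwards [self_mem_nhdsWithin] with y hy
  obtain ⟨z, hz, hzy⟩ := exists_lt_of_csInf_lt hne (mem_Ioi.1 hy)
  exact le_trans hz (monotone_cdf μ hzy.le)

theorem leftInv_mono (μ : Measure ℝ) {c d : ℝ} (h0 : 0 < c) (hcd : c ≤ d) (h1 : d < 1) :
    leftInv μ c ≤ leftInv μ d :=
  (leftInv_le_iff μ h0 (hcd.trans_lt h1) _).2
    (hcd.trans ((leftInv_le_iff μ (h0.trans_le hcd) h1 _).1 le_rfl))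

/-- Here and for levels above `1` the value is the convention for `sInf` of `univ` or `∅`. It
matters only for measurability on all of `ℝ`. -/
theorem leftInv_of_nonpos (μ : Measure ℝ) {c : ℝ} (hc : c ≤ 0) : leftInv μ c = 0 := by
  have : {x | c ≤ cdf μ x} = univ := eq_univ_of_forall fun x ↦ hc.trans (cdf_nonneg μ x)
  rw [leftInv, this, Real.sInf_univ]

theorem leftInv_of_one_lt (μ : Measure ℝ) {c : ℝ} (hc : 1 < c) : leftInv μ c = 0 := by
  have : {x | c ≤ cdf μ x} = ∅ :=
    eq_empty_of_forall_notMem fun x hx ↦ absurd (hx.trans (cdf_le_one μ x)) (not_le.2 hc)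
  rw [leftInv, this, Real.sInf_empty]

/-- On `(0, 1)` sublevel sets are intervals by the adjunction, and outside `[0, 1]` the function is
constant. The level `1` is a single point, so its value there need not be known. -/
theorem measurable_leftInv (μ : Measure ℝ) : Measurable (leftInv μ) := by
  refine measurable_of_Iic fun y ↦ ?_
  have : leftInv μ ⁻¹' Iic y = (Ioo 0 1 ∩ Iic (cdf μ y)) ∪ ({1} ∩ leftInv μ ⁻¹' Iic y)
      ∪ ((Iic 0 ∪ Ioi 1) ∩ {_c : ℝ | 0 ≤ y}) := by
    ext c
    simp only [mem_preimage, mem_Iic, mem_union, mem_inter_iff, mem_Ioo, mem_singleton_iff,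
      mem_Ioi, mem_ofPred_eq]
    rcases le_or_gt c 0 with h0 | h0
    · simp [leftInv_of_nonpos μ h0, h0, h0.not_gt, (h0.trans_lt one_pos).ne]
    rcases lt_trichotomy c 1 with h1 | h1 | h1
    · simp [leftInv_le_iff μ h0 h1, h0, h1, h0.not_ge, h1.not_gt, h1.ne]
    · simp [h1]
    · simp [leftInv_of_one_lt μ h1, h1, h1.not_gt, h1.ne']
  rw [this]
  refine ((measurableSet_Ioo.inter measurableSet_Iic).union ?_).union
    ((measurableSet_Iic.union measurableSet_Ioi).inter (MeasurableSet.const _))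
  exact (subsingleton_singleton.anti inter_subset_left).measurableSet

/-- The (randomized) probability integral transform. -/
def rankTransform (μ : Measure ℝ) (x u : ℝ) : ℝ := μ.real (Iio x) + u * μ.real {x}

variable (μ : Measure ℝ) [IsProbabilityMeasure μ]

theorem real_Iio_add_singleton (x : ℝ) : μ.real (Iio x) + μ.real {x} = cdf μ x := by
  rw [cdf_eq_real, ← Iio_union_right, measureReal_union (by simp) (measurableSet_singleton x)]

theorem measurable_rankTransform : Measurable (Function.uncurry (rankTransform μ)) := by
  have h1 : Measurable fun x ↦ μ.real (Iio x) :=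
    Monotone.measurable fun x y hxy ↦ measureReal_mono (Iio_subset_Iio hxy)
  have h2 : Measurable fun x ↦ μ.real {x} := by
    have : (fun x ↦ μ.real {x}) = fun x ↦ cdf μ x - μ.real (Iio x) := by
      funext x; rw [← real_Iio_add_singleton μ x]; ring
    rw [this]
    exact (monotone_cdf μ).measurable.sub h1
  exact (h1.comp measurable_fst).add (measurable_snd.mul (h2.comp measurable_fst))

theorem measurable_comonotone (ν : Measure ℝ) : 
    Measurable fun p : ℝ × ℝ ↦ comonotone μ ν p.1 p.2 :=
  (measurable_leftInv ν).comp (measurable_rankTransform μ)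

theorem rankTransform_le_cdf {u : ℝ} (hu : u ≤ 1) (x : ℝ) : rankTransform μ x u ≤ cdf μ x := by
  rw [← real_Iio_add_singleton μ x, rankTransform]
  have : 0 ≤ μ.real {x} := measureReal_nonneg
  nlinarith

theorem cdf_le_rankTransform {u : ℝ} (hu : 0 ≤ u) {x y : ℝ} (hxy : x < y) :
    cdf μ x ≤ rankTransform μ y u := by
  have h1 : cdf μ x ≤ μ.real (Iio y) := by
    rw [cdf_eq_real]; exact measureReal_mono (Iic_subset_Iio.2 hxy)
  have : 0 ≤ u * μ.real {y} := mul_nonneg hu measureReal_nonneg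
  rw [rankTransform]; linarith

/-- The rank transform is monotone for the lexicographic order. -/
theorem rankTransform_mono {x y u v : ℝ} (hu : u ≤ 1) (hv : 0 ≤ v)
    (h : x < y ∨ x = y ∧ u < v) : rankTransform μ x u ≤ rankTransform μ y v := by
  rcases h with h | ⟨rfl, h⟩
  · exact (rankTransform_le_cdf μ hu x).trans (cdf_le_rankTransform μ hv h)
  · unfold rankTransform
    gcongr

/-- The left-hand side is the left limit of the distribution function at the quantile, and strictly
before the quantile its values are below `c`. -/
theorem real_Iio_leftInv_le {c : ℝ} (h0 : 0 < c) (h1 : c < 1) :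
    μ.real (Iio (leftInv μ c)) ≤ c := by
  have h : μ.real (Iio (leftInv μ c)) = Function.leftLim (cdf μ) (leftInv μ c) := by
    have h2 : (0 : ℝ) ≤ Function.leftLim (cdf μ) (leftInv μ c) :=
      (cdf_nonneg μ _).trans ((monotone_cdf μ).le_leftLim (sub_one_lt (leftInv μ c)))
    rw [measureReal_def]
    nth_rewrite 1 [← measure_cdf μ]
    rw [StieltjesFunction.measure_Iio _ (tendsto_cdf_atBot μ), sub_zero, ENNReal.toReal_ofReal h2]
  rw [h]
  refine le_of_tendsto ((monotone_cdf μ).tendsto_leftLim _) ?_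
  filter_upwards [self_mem_nhdsWithin] with y hy
  exact le_of_lt (not_le.1 fun hc ↦ absurd ((leftInv_le_iff μ h0 h1 y).2 hc) (not_le.2 hy))

variable {Ω : Type*} [MeasurableSpace Ω] {P : Measure Ω}

theorem IsStandardUniform.ae_mem {V : Ω → ℝ} (hV : IsStandardUniform V P) :
    ∀ᵐ ω ∂P, V ω ∈ Icc (0 : ℝ) 1 := by
  refine ae_of_ae_map (p := fun x ↦ x ∈ Icc (0 : ℝ) 1) hV.1.aemeasurable ?_
  rw [hV.2]
  exact ae_restrict_mem measurableSet_Icc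

theorem IsStandardUniform.real_le {V : Ω → ℝ} (hV : IsStandardUniform V P) {r : ℝ} (h0 : 0 ≤ r)
    (h1 : r ≤ 1) : P.real (V ⁻¹' Iic r) = r := by
  rw [← map_measureReal_apply hV.1 measurableSet_Iic, hV.2,
    measureReal_restrict_apply measurableSet_Iic]
  have : Iic r ∩ Icc 0 1 = Icc 0 r := by
    ext x
    exact ⟨fun h ↦ ⟨h.2.1, h.1⟩, fun h ↦ ⟨h.2, h.1, h.2.trans h1⟩⟩
  rw [this, Real.volume_real_Icc_of_le h0, sub_zero]

variable {μ} [IsProbabilityMeasure P] {X V : Ω → ℝ} (hX : HasLaw X μ P) (hXm : Measurable X) (hV : IsStandardUniform V P)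
  (hindep : IndepFun X V P)
include hX hXm hV hindep

/-- With `q` the `c`-quantile, `E` consists of `{X < q}` and the fraction `r` of the atom `{X = q}`
cut out by `V ≤ r`. The fraction is chosen so that independence gives `E` probability exactly `c`;
up to null sets `E` lies between `{rank < c}` and `{rank ≤ c}`. -/
theorem exists_real_eq_of_rankTransform {c : ℝ} (h0 : 0 < c) (h1 : c < 1) :
    ∃ E : Set Ω, P.real E = c ∧ (∀ᵐ ω ∂P, rankTransform μ (X ω) (V ω) < c → ω ∈ E) ∧
      ∀ᵐ ω ∂P, ω ∈ E → rankTransform μ (X ω) (V ω) ≤ c := by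
  let q := leftInv μ c
  let a := μ.real (Iio q)
  let m := μ.real {q}
  -- If there is no atom, `m = 0` and `r = 0` by the division convention. Then `a ≤ c ≤ a + m`
  -- forces `a = c`, so `m * r = c - a` still holds.
  let r := (c - a) / m
  have hac : a ≤ c := real_Iio_leftInv_le μ h0 h1
  have hm : 0 ≤ m := measureReal_nonneg
  have ham : c ≤ a + m := by
    rw [real_Iio_add_singleton μ q]
    exact (leftInv_le_iff μ h0 h1 q).1 le_rfl
  have hmr : m * r = c - a := by
    rcases hm.eq_or_lt with h | h
    · rw [← h]; linarith
    · exact mul_div_cancel₀ _ h.ne'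
  have hr0 : 0 ≤ r := div_nonneg (by linarith) hm
  have hr1 : r ≤ 1 := div_le_one_of_le₀ (by linarith) hm
  refine ⟨X ⁻¹' Iio q ∪ (X ⁻¹' {q} ∩ V ⁻¹' Iic r), ?_, ?_, ?_⟩
  · rw [measureReal_union]
    · have h2 : P.real (X ⁻¹' {q} ∩ V ⁻¹' Iic r) = m * r := by
        rw [measureReal_def, hindep.measure_inter_preimage_eq_mul _ _ (measurableSet_singleton q)
          measurableSet_Iic, ENNReal.toReal_mul, ← measureReal_def, ← measureReal_def,
          hV.real_le hr0 hr1, ← map_measureReal_apply hXm (measurableSet_singleton q), hX.map_eq]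
      rw [h2, ← map_measureReal_apply hXm measurableSet_Iio, hX.map_eq, hmr]
      simp [a]
    · refine disjoint_left.2 fun ω h1 h2 ↦ ?_
      have h3 : X ω = q := h2.1
      exact absurd h3 (ne_of_lt h1)
    · exact (hXm (measurableSet_singleton q)).inter (hV.1 measurableSet_Iic)
  · filter_upwards [hV.ae_mem] with ω hω hlt
    rcases lt_trichotomy (X ω) q with h | h | h
    · exact Or.inl h
    · refine Or.inr ⟨h, ?_⟩
      rw [rankTransform, h] at hlt
      change V ω ≤ r
      by_contra hcon
      have h3 : r * m ≤ V ω * m := mul_le_mul_of_nonneg_right (not_le.1 hcon).le hm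
      have h4 : a + V ω * m < c := hlt
      linarith
    · have h2 := cdf_le_rankTransform μ hω.1 h
      rw [← real_Iio_add_singleton μ q] at h2
      have h3 : a + m ≤ rankTransform μ (X ω) (V ω) := h2
      linarith
  · filter_upwards [hV.ae_mem] with ω hω hE
    rcases hE with h | ⟨h, h'⟩
    · refine (rankTransform_le_cdf μ hω.2 _).trans (le_of_lt (not_le.1 fun hc ↦ ?_))
      exact absurd ((leftInv_le_iff μ h0 h1 _).2 hc) (not_le.2 h)
    · have h2 : X ω = q := h
      rw [rankTransform, h2]
      change a + V ω * m ≤ c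
      have h3 : V ω * m ≤ r * m := mul_le_mul_of_nonneg_right h' hm
      linarith

theorem real_rankTransform_lt_le {c : ℝ} (h0 : 0 < c) (h1 : c < 1) :
    P.real {ω | rankTransform μ (X ω) (V ω) < c} ≤ c := by
  obtain ⟨E, hE, hE1, -⟩ := exists_real_eq_of_rankTransform hX hXm hV hindep h0 h1
  exact (ENNReal.toReal_mono (measure_ne_top _ _) (measure_mono_ae hE1)).trans_eq hE

theorem le_real_rankTransform_le {c : ℝ} (h0 : 0 < c) (h1 : c < 1) :
    c ≤ P.real {ω | rankTransform μ (X ω) (V ω) ≤ c} := by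
  obtain ⟨E, hE, -, hE1⟩ := exists_real_eq_of_rankTransform hX hXm hV hindep h0 h1
  exact hE.symm.trans_le <| ENNReal.toReal_mono (measure_ne_top _ _) (measure_mono_ae hE1)

/-- The rank transform of a randomized variable is uniformly distributed. -/
theorem real_rankTransform_le {c : ℝ} (h0 : 0 ≤ c) (h1 : c ≤ 1) :
    P.real {ω | rankTransform μ (X ω) (V ω) ≤ c} = c := by
  apply le_antisymm
  · rcases h1.eq_or_lt with rfl | h1
    · exact measureReal_le_one
    -- `{rank ≤ c}` lies in `{rank < d}` for every `d > c`; let `d` decrease to `c`.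
    refine le_of_forall_gt_imp_ge_of_dense fun d hd ↦ ?_
    rcases lt_or_ge d 1 with hd1 | hd1
    · exact (measureReal_mono fun ω hω ↦ lt_of_le_of_lt hω hd).trans
        (real_rankTransform_lt_le hX hXm hV hindep (h0.trans_lt hd) hd1)
    · exact measureReal_le_one.trans hd1
  · rcases h0.eq_or_lt with rfl | h0
    · exact measureReal_nonneg
    rcases h1.eq_or_lt with rfl | h1
    · have : ∀ᵐ ω ∂P, rankTransform μ (X ω) (V ω) ≤ 1 := by
        filter_upwards [hV.ae_mem] with ω hω
        exact (rankTransform_le_cdf μ hω.2 _).trans (cdf_le_one μ _)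
      rw [measureReal_congr (eventuallyEq_univ.2 this), probReal_univ]
    · exact le_real_rankTransform_le hX hXm hV hindep h0 h1

/-- A uniform variable avoids `0` and `1`. This is needed because `leftInv` is an adjoint only at
levels inside `(0, 1)`. -/
theorem ae_rankTransform_mem : ∀ᵐ ω ∂P, rankTransform μ (X ω) (V ω) ∈ Ioo (0 : ℝ) 1 := by
  have hG : Measurable fun ω ↦ rankTransform μ (X ω) (V ω) :=
    (measurable_rankTransform μ).comp (hXm.prodMk hV.1)
  have h0 : ∀ᵐ ω ∂P, 0 < rankTransform μ (X ω) (V ω) := by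
    have h := real_rankTransform_le hX hXm hV hindep le_rfl zero_le_one
    rw [measureReal_eq_zero_iff] at h
    filter_upwards [measure_eq_zero_iff_ae_notMem.1 h] with ω hω
    exact not_le.1 hω
  have h1 : ∀ᵐ ω ∂P, rankTransform μ (X ω) (V ω) < 1 := by
    have h : P.real {ω | rankTransform μ (X ω) (V ω) < 1} = 1 := by
      refine le_antisymm measureReal_le_one (le_of_forall_lt_imp_le_of_dense fun d hd ↦ ?_)
      rcases le_or_gt d 0 with hd0 | hd0
      · exact hd0.trans measureReal_nonneg
      · rw [← real_rankTransform_le hX hXm hV hindep hd0.le hd.le]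
        exact measureReal_mono fun ω hω ↦ lt_of_le_of_lt hω hd
    have h2 : P {ω | rankTransform μ (X ω) (V ω) < 1} = 1 := by
      rw [← ENNReal.toReal_eq_one_iff]; exact h
    exact (prob_compl_eq_zero_iff (measurableSet_lt hG measurable_const)).2 h2
  filter_upwards [h0, h1] with ω h h' using ⟨h, h'⟩

/-- The comonotone coupling has the prescribed second marginal. -/
theorem hasLaw_comonotone (ν : Measure ℝ) [IsProbabilityMeasure ν] :
    HasLaw (fun ω ↦ comonotone μ ν (X ω) (V ω)) ν P := by
  have hξ : Measurable fun ω ↦ comonotone μ ν (X ω) (V ω) := by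
    have h := (measurable_comonotone μ ν).comp (hXm.prodMk hV.1)
    exact h
  refine ⟨hξ.aemeasurable, ?_⟩
  have : IsProbabilityMeasure (P.map fun ω ↦ comonotone μ ν (X ω) (V ω)) :=
    Measure.isProbabilityMeasure_map hξ.aemeasurable
  refine Measure.ext_of_Iic _ _ fun y ↦ ?_
  have h1 : P.real {ω | rankTransform μ (X ω) (V ω) ≤ cdf ν y} = cdf ν y :=
    real_rankTransform_le hX hXm hV hindep (cdf_nonneg ν y) (cdf_le_one ν y)
  have h2 : P.real ((fun ω ↦ comonotone μ ν (X ω) (V ω)) ⁻¹' Iic y)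
      = P.real {ω | rankTransform μ (X ω) (V ω) ≤ cdf ν y} := by
    refine measureReal_congr ?_
    filter_upwards [ae_rankTransform_mem hX hXm hV hindep] with ω hω
    exact propext (leftInv_le_iff ν hω.1 hω.2 y)
  rw [h1, cdf_eq_real, ← map_measureReal_apply hξ measurableSet_Iic] at h2
  exact (measureReal_eq_measureReal_iff).1 h2

end Comonotone

/-! ### Independence of grouped variables, and increments of Lévy processes. -/

section Independence

theorem measurable_biSup_of_mem {Ω ι α : Type*} [MeasurableSpace α] {m : ι → MeasurableSpace Ω}
    {S : Set ι} {i : ι} (hi : i ∈ S) {f : Ω → α} (hf : Measurable[m i] f) :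
    Measurable[⨆ i ∈ S, m i] f :=
  hf.mono (le_iSup₂_of_le i hi le_rfl) le_rfl

theorem measurable_pathSigma {Ω : Type*} {s : Set ℝ≥0} {Y : ℝ≥0 → Ω → ℝ} {t : ℝ≥0} (ht : t ∈ s) :
    Measurable[pathSigma s Y] (Y t) :=
  (comap_measurable (Y t)).mono (le_iSup₂_of_le t ht le_rfl) le_rfl

variable {Ω : Type*} [mΩ : MeasurableSpace Ω] {P : Measure Ω}

/-- If two families are independent of each other and each consists of independent variables, then
the pairs are independent. -/
theorem iIndepFun_prodMk {ι α β : Type*} [Fintype ι] [MeasurableSpace α] [MeasurableSpace β]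
    {A : ι → Ω → α} {B : ι → Ω → β} (hAm : ∀ i, Measurable (A i)) (hBm : ∀ i, Measurable (B i))
    (hA : iIndepFun A P) (hB : iIndepFun B P)
    (hAB : IndepFun (fun ω i ↦ A i ω) (fun ω i ↦ B i ω) P) :
    iIndepFun (fun i ω ↦ (A i ω, B i ω)) P := by
  have hP := hA.isProbabilityMeasure
  have hA' : Measurable fun ω i ↦ A i ω := measurable_pi_iff.2 hAm
  have hB' : Measurable fun ω i ↦ B i ω := measurable_pi_iff.2 hBm
  have hi : ∀ i, IndepFun (A i) (B i) P := fun i ↦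
    hAB.comp (φ := fun x : ι → α ↦ x i) (ψ := fun x : ι → β ↦ x i)
      (measurable_pi_apply i) (measurable_pi_apply i)
  rw [iIndepFun_iff_map_fun_eq_pi_map fun i ↦ ((hAm i).prodMk (hBm i)).aemeasurable]
  have hpair : ∀ i, P.map (fun ω ↦ (A i ω, B i ω)) = (P.map (A i)).prod (P.map (B i)) := fun i ↦
    (indepFun_iff_map_prod_eq_prod_map_map (hAm i).aemeasurable (hBm i).aemeasurable).1 (hi i)
  have hvec := (indepFun_iff_map_prod_eq_prod_map_map hA'.aemeasurable hB'.aemeasurable).1 hAB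
  rw [hA.map_fun_eq_pi_map fun i ↦ (hAm i).aemeasurable,
    hB.map_fun_eq_pi_map fun i ↦ (hBm i).aemeasurable] at hvec
  have : ∀ i, IsProbabilityMeasure (P.map (A i)) := fun i ↦
    Measure.isProbabilityMeasure_map (hAm i).aemeasurable
  have : ∀ i, IsProbabilityMeasure (P.map (B i)) := fun i ↦
    Measure.isProbabilityMeasure_map (hBm i).aemeasurable
  -- The law of `(A, B)` is the product of the two product laws; regrouping coordinates turns it
  -- into the product over `i` of the laws of the pairs.
  have hmp := (measurePreserving_arrowProdEquivProdArrow α β ι (fun i ↦ P.map (A i))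
    (fun i ↦ P.map (B i))).symm
  simp_rw [hpair]
  rw [← hmp.map_eq, ← hvec, Measure.map_map hmp.measurable (hA'.prodMk hB')]
  rfl

/-- Variables measurable with respect to disjoint groups of independent σ-algebras are
independent. -/
theorem indepFun_of_iIndep {ι α β : Type*} [MeasurableSpace α] [MeasurableSpace β]
    {m : ι → MeasurableSpace Ω} (hle : ∀ i, m i ≤ mΩ) (hm : iIndep m P) {S T : Set ι}
    (hST : Disjoint S T) {f : Ω → α} {g : Ω → β} (hf : Measurable[⨆ i ∈ S, m i] f)
    (hg : Measurable[⨆ i ∈ T, m i] g) : IndepFun f g P := by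
  rw [IndepFun_iff_Indep]
  exact indep_of_indep_of_le (indep_iSup_of_disjoint hle hm hST) hf.comap_le hg.comap_le

theorem pathSigma_le {s : Set ℝ≥0} {Y : ℝ≥0 → Ω → ℝ} (hY : ∀ t ∈ s, Measurable (Y t)) :
    pathSigma s Y ≤ mΩ :=
  iSup₂_le fun t ht ↦ (hY t ht).comap_le

/-- Independent variables, one of which has no atoms, are almost surely distinct. -/
theorem IndepFun.ae_ne [IsProbabilityMeasure P] {A B : Ω → ℝ} (hA : AEMeasurable A P)
    (hB : AEMeasurable B P) (hAB : IndepFun A B P) (hna : ∀ x, P.map B {x} = 0) :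
    ∀ᵐ ω ∂P, A ω ≠ B ω := by
  have h1 := (indepFun_iff_map_prod_eq_prod_map_map hA hB).1 hAB
  have hD : MeasurableSet {p : ℝ × ℝ | p.1 = p.2} :=
    measurableSet_eq_fun measurable_fst measurable_snd
  have : IsProbabilityMeasure (P.map B) := Measure.isProbabilityMeasure_map hB
  have h2 : P.map (fun ω ↦ (A ω, B ω)) {p : ℝ × ℝ | p.1 = p.2} = 0 := by
    rw [h1, Measure.prod_apply hD]
    refine lintegral_eq_zero_of_ae_eq_zero (ae_of_all _ fun x ↦ ?_)
    have : Prod.mk x ⁻¹' {p : ℝ × ℝ | p.1 = p.2} = {x} := by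
      ext y; simp [eq_comm]
    simp only [this, hna, Pi.zero_apply]
  rw [Measure.map_apply_of_aemeasurable (hA.prodMk hB) hD] at h2
  exact measure_eq_zero_iff_ae_notMem.1 h2

theorem IsLevyProcess.iIndepFun_incr {X : ℝ≥0 → Ω → ℝ} (hX : IsLevyProcess X P) (k : ℕ) :
    iIndepFun (fun (i : Fin k) ω ↦ incr k (X · ω) i) P :=
  hX.indepIncrements k (fun i ↦ gridPt k i) fun _ _ hij ↦ gridPt_mono hij

theorem IsLevyProcess.identDistrib_incr {X : ℝ≥0 → Ω → ℝ} (hX : IsLevyProcess X P) {k : ℕ}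
    (i : Fin k) : IdentDistrib (fun ω ↦ incr k (X · ω) i) (X (1 / (k : ℝ≥0))) P P := by
  have h := hX.stationaryIncrements (gridPt k i) (1 / (k : ℝ≥0))
  rwa [← gridPt_succ] at h

/-- The sum telescopes. This exhibits the end point of `X` as a symmetric function of its
increments. -/
theorem sum_incr {k : ℕ} (hk : 0 < k) (x : ℝ≥0 → ℝ) : ∑ i, incr k x i = x 1 - x 0 := by
  unfold incr
  rw [Fin.sum_univ_eq_sum_range (fun i ↦ x (gridPt k (i + 1)) - x (gridPt k i)) k,
    Finset.sum_range_sub (fun i ↦ x (gridPt k i)), gridPt_self hk]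
  simp [gridPt]

end Independence

/-! ### Random choices that are uniform, and permutations of i.i.d. families. -/

section Exchangeability

variable {Ω : Type*} [MeasurableSpace Ω] {P : Measure Ω}

theorem measure_eq_sum_of_ae_existsUnique {ι : Type*} [Fintype ι] {M : ι → Set Ω}
    (hM : ∀ i, NullMeasurableSet (M i) P) (h : ∀ᵐ ω ∂P, ∃! i, ω ∈ M i) {E : Set Ω}
    (hE : NullMeasurableSet E P) : P E = ∑ i, P (M i ∩ E) := by
  have h1 : E =ᵐ[P] ⋃ i, M i ∩ E := by
    filter_upwards [h] with ω ⟨i, hi, _⟩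
    refine propext ⟨fun hω ↦ mem_iUnion.2 ⟨i, hi, hω⟩, fun hω ↦ ?_⟩
    obtain ⟨j, hj⟩ := mem_iUnion.1 hω
    exact hj.2
  rw [measure_congr h1, measure_iUnion₀, tsum_fintype]
  · intro i j hij
    refine measure_eq_zero_iff_ae_notMem.2 ?_
    filter_upwards [h] with ω hω hmem
    exact hij (hω.unique hmem.1.1 hmem.2.1)
  · exact fun i ↦ (hM i).inter hE

/-- A uniform random choice among variables with the same law has this law. -/
theorem hasLaw_of_uniform_choice {ι α : Type*} [Fintype ι] [Nonempty ι] [MeasurableSpace α]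
    {M : ι → Set Ω} (hM : ∀ i, NullMeasurableSet (M i) P) (h : ∀ᵐ ω ∂P, ∃! i, ω ∈ M i)
    {γ : Measure α} {G : ι → Ω → α} (hG : ∀ i, HasLaw (G i) γ P)
    (hunif : ∀ i, ∀ A, MeasurableSet A →
      (Fintype.card ι : ℝ≥0∞) * P (M i ∩ G i ⁻¹' A) = P (G i ⁻¹' A))
    {F : Ω → α} (hF : ∀ i, ∀ᵐ ω ∂P, ω ∈ M i → F ω = G i ω) : HasLaw F γ P := by
  -- `F` is not assumed measurable. It agrees almost surely with `G i` on `M i`, and these sets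
  -- cover almost all of the space.
  have hFm : AEMeasurable F P := by
    have hU : P.restrict (⋃ i, M i) = P := by
      refine Measure.restrict_eq_self_of_ae_mem ?_
      filter_upwards [h] with ω ⟨i, hi, _⟩ using mem_iUnion.2 ⟨i, hi⟩
    rw [← hU, aemeasurable_iUnion_iff]
    intro i
    refine (hG i).aemeasurable.restrict.congr ?_
    rw [EventuallyEq, ae_restrict_iff'₀ (hM i)]
    filter_upwards [hF i] with ω hω hi using (hω hi).symm
  refine ⟨hFm, Measure.ext fun A hA ↦ ?_⟩
  rw [Measure.map_apply_of_aemeasurable hFm hA,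
    measure_eq_sum_of_ae_existsUnique hM h (hFm.nullMeasurable hA)]
  have hN0 : (Fintype.card ι : ℝ≥0∞) ≠ 0 := by exact_mod_cast Fintype.card_ne_zero
  have h1 : ∀ i, P (M i ∩ F ⁻¹' A) = (Fintype.card ι : ℝ≥0∞)⁻¹ * γ A := by
    intro i
    have h2 : P (M i ∩ F ⁻¹' A) = P (M i ∩ G i ⁻¹' A) := by
      refine measure_congr ?_
      filter_upwards [hF i] with ω hω
      refine propext (and_congr_right fun hi ↦ ?_)
      change F ω ∈ A ↔ G i ω ∈ A
      rw [hω hi]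
    have h3 : γ A = (Fintype.card ι : ℝ≥0∞) * P (M i ∩ G i ⁻¹' A) := by
      rw [hunif i A hA, ← (hG i).map_eq, Measure.map_apply_of_aemeasurable (hG i).aemeasurable hA]
    rw [h2, h3, ← mul_assoc, ENNReal.inv_mul_cancel hN0 (ENNReal.natCast_ne_top _), one_mul]
  simp_rw [h1]
  rw [Finset.sum_const, Finset.card_univ, nsmul_eq_mul, ← mul_assoc,
    ENNReal.mul_inv_cancel hN0 (ENNReal.natCast_ne_top _), one_mul]

/-- Permuting a family of independent, identically distributed variables does not change the
joint law with an independent variable. -/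
theorem identDistrib_perm {ι α β : Type*} [Fintype ι] [MeasurableSpace α] [MeasurableSpace β]
    [IsProbabilityMeasure P] {Z : ι → Ω → α} {Y : Ω → β} (hY : Measurable Y) (hZ : iIndepFun Z P) (hid : ∀ i j, IdentDistrib (Z i) (Z j) P P)
    (hZY : IndepFun (fun ω i ↦ Z i ω) Y P) (τ : Equiv.Perm ι) :
    IdentDistrib (fun ω ↦ (fun i ↦ Z (τ i) ω, Y ω)) (fun ω ↦ (fun i ↦ Z i ω, Y ω)) P P := by
  refine IdentDistrib.prodMk ?_ (IdentDistrib.refl hY.aemeasurable) ?_ hZY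
  · exact IdentDistrib.pi (fun i ↦ hid _ _) (hZ.precomp τ.injective) hZ
  · exact hZY.comp (φ := fun (z : ι → α) i ↦ z (τ i))
      (measurable_pi_iff.2 fun i ↦ measurable_pi_apply _) measurable_id

end Exchangeability

/-! ### Permutations matching two orderings. -/

section Matching

/-- `σ` matches the order of the numbers `a i` with the lexicographic order of the pairs `z i`. -/
def Matches {k : ℕ} (a : Fin k → ℝ) (z : Fin k → ℝ × ℝ) (σ : Equiv.Perm (Fin k)) : Prop :=
  ∀ i j, i ≠ j → (a (σ i) < a (σ j) ↔
    (z i).1 < (z j).1 ∨ ((z i).1 = (z j).1 ∧ (z i).2 < (z j).2))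

/-- This is the substitution of `τ i`, `τ j` for `i`, `j`. Through it a relabelling of `z` carries
any candidate permutation to any other. -/
theorem matches_comp {k : ℕ} (a : Fin k → ℝ) (z : Fin k → ℝ × ℝ) (σ τ : Equiv.Perm (Fin k)) :
    Matches a (z ∘ τ) (σ * τ) ↔ Matches a z σ := by
  refine ⟨fun h i j hij ↦ ?_, fun h i j hij ↦ h _ _ (τ.injective.ne hij)⟩
  simpa using h (τ.symm i) (τ.symm j) (τ.symm.injective.ne hij)

/-- If `s` sorts `a` and `r` sorts `z` lexicographically, the matching permutation is `s ∘ r⁻¹`. It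
is unique because `a ∘ σ ∘ r` and `a ∘ s` both enumerate the range of `a` increasingly. -/
theorem existsUnique_matches {k : ℕ} {a : Fin k → ℝ} {z : Fin k → ℝ × ℝ}
    (ha : Function.Injective a) (hz : Function.Injective z) : ∃! σ, Matches a z σ := by
  let g : Fin k → ℝ ×ₗ ℝ := fun i ↦ toLex (z i)
  have hg : Function.Injective g := toLex.injective.comp hz
  have hlt : ∀ i j, g i < g j ↔
      (z i).1 < (z j).1 ∨ ((z i).1 = (z j).1 ∧ (z i).2 < (z j).2) := fun i j ↦ Prod.Lex.lt_iff
  let s := Tuple.sort a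
  let r := Tuple.sort g
  have hs : StrictMono (a ∘ s) :=
    (Tuple.monotone_sort a).strictMono_of_injective (ha.comp s.injective)
  have hr : StrictMono (g ∘ r) :=
    (Tuple.monotone_sort g).strictMono_of_injective (hg.comp r.injective)
  refine ⟨r.symm.trans s, fun i j _ ↦ ?_, fun σ hσ ↦ ?_⟩
  · rw [← hlt]
    have h1 := hs.lt_iff_lt (a := r.symm i) (b := r.symm j)
    have h2 := hr.lt_iff_lt (a := r.symm i) (b := r.symm j)
    simp only [Function.comp_apply, Equiv.apply_symm_apply] at h1 h2
    rw [h2, ← h1]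
    rfl
  · have h1 : StrictMono (a ∘ σ ∘ r) := fun i j hij ↦
      (hσ _ _ (r.injective.ne hij.ne)).2 ((hlt _ _).1 (hr hij))
    have h2 : a ∘ σ ∘ r = a ∘ s := by
      refine (StrictMono.range_inj h1 hs).1 ?_
      rw [range_comp, range_comp a s, s.surjective.range_eq,
        (σ.surjective.comp r.surjective).range_eq]
    ext i
    have h3 := ha (congrFun h2 (r.symm i))
    simp only [Function.comp_apply, Equiv.apply_symm_apply] at h3
    rw [h3]
    rfl

theorem measurableSet_matches {k : ℕ} (σ : Equiv.Perm (Fin k)) :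
    MeasurableSet {p : (Fin k → ℝ × ℝ) × (ℝ≥0 → ℝ) | Matches (incr k p.2) p.1 σ} := by
  have hw : ∀ i, Measurable fun p : (Fin k → ℝ × ℝ) × (ℝ≥0 → ℝ) ↦ incr k p.2 i := fun i ↦ by
    unfold incr; fun_prop
  have hz1 : ∀ i, Measurable fun p : (Fin k → ℝ × ℝ) × (ℝ≥0 → ℝ) ↦ (p.1 i).1 := fun i ↦ by
    fun_prop
  have hz2 : ∀ i, Measurable fun p : (Fin k → ℝ × ℝ) × (ℝ≥0 → ℝ) ↦ (p.1 i).2 := fun i ↦ by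
    fun_prop
  have hlt : ∀ {f g : (Fin k → ℝ × ℝ) × (ℝ≥0 → ℝ) → ℝ}, Measurable f → Measurable g →
      Measurable fun p ↦ f p < g p := fun hf hg ↦ measurableSet_setOfPred.1 (measurableSet_lt hf hg)
  have heq : ∀ {f g : (Fin k → ℝ × ℝ) × (ℝ≥0 → ℝ) → ℝ}, Measurable f → Measurable g →
      Measurable fun p ↦ f p = g p := fun hf hg ↦
    measurableSet_setOfPred.1 (measurableSet_eq_fun hf hg)
  refine measurableSet_setOfPred.2 (Measurable.forall fun i ↦ Measurable.forall fun j ↦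
    Measurable.imp measurable_const ((hlt (hw _) (hw _)).iff ?_))
  exact (hlt (hz1 _) (hz1 _)).or ((heq (hz1 _) (hz1 _)).and (hlt (hz2 _) (hz2 _)))

end Matching

/-! ### Uniformity of the matching permutation, and reordered Brownian motion. -/

section Reordering

variable {Ω : Type*}

theorem reorderedBM_congr {k : ℕ} {W W' : ℝ≥0 → Ω → ℝ} {π π' : Ω → Equiv.Perm (Fin k)} {ω : Ω}
    (h : ∀ t ≤ 1, W t ω = W' t ω) (hπ : π ω = π' ω) (t : ℝ≥0) :
    reorderedBM k W π t ω = reorderedBM k W' π' t ω := by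
  unfold reorderedBM concat
  refine Finset.sum_congr rfl fun i _ ↦ ?_
  simp only [hπ, h _ (gridPt_add_le_one (π' ω i) (min_le_right _ _)),
    h _ (gridPt_le_one (π' ω i))]

theorem incr_congr {k : ℕ} {w w' : ℝ≥0 → ℝ} (h : ∀ t ≤ 1, w t = w' t) : incr k w = incr k w' := by
  funext i
  have h1 : gridPt k (i + 1) ≤ 1 := by rw [gridPt_succ]; exact gridPt_add_le_one i le_rfl
  rw [incr, incr, h _ h1, h _ (gridPt_le_one i)]

theorem incr_reorderedBM {k : ℕ} (W : ℝ≥0 → Ω → ℝ) (π : Ω → Equiv.Perm (Fin k)) (ω : Ω)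
    (i : Fin k) : incr k (reorderedBM k W π · ω) i = incr k (W · ω) (π ω i) := by
  have h := incr_concat (fun i s ↦ W (gridPt k (π ω i) + s) ω - W (gridPt k (π ω i)) ω) i
  exact h.trans (by rw [incr, gridPt_succ])

theorem continuous_reorderedBM {k : ℕ} {W : ℝ≥0 → Ω → ℝ} (π : Ω → Equiv.Perm (Fin k)) {ω : Ω}
    (h : ContinuousOn (W · ω) (Iic 1)) : Continuous (reorderedBM k W π · ω) := by
  refine continuous_concat (fun i ↦ by simp) fun i ↦ ?_
  refine ContinuousOn.sub (h.comp (f := fun s ↦ gridPt k (π ω i) + s) (by fun_prop) ?_)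
    continuousOn_const
  exact fun s hs ↦ mem_Iic.2 (gridPt_add_le_one _ (mem_Iic.1 hs))

variable [MeasurableSpace Ω] {P : Measure Ω}

/-- A permutation matching an exchangeable family with a symmetric function of it is uniformly
distributed and independent of this function. -/
theorem card_mul_measure_matches [IsProbabilityMeasure P] {k : ℕ} {β : Type*} [MeasurableSpace β]
    {Z : Fin k → Ω → ℝ × ℝ} {Y : Ω → β} (hZm : ∀ i, Measurable (Z i)) (hY : Measurable Y)
    (hZ : iIndepFun Z P) (hid : ∀ i j, IdentDistrib (Z i) (Z j) P P)
    (hZY : IndepFun (fun ω i ↦ Z i ω) Y P) {Φ : (Fin k → ℝ × ℝ) → β → ℝ≥0 → ℝ}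
    (hΦ : Measurable fun p : (Fin k → ℝ × ℝ) × β ↦ Φ p.1 p.2)
    (hsymm : ∀ z (τ : Equiv.Perm (Fin k)) y, Φ (z ∘ τ) y = Φ z y)
    (hex : ∀ᵐ ω ∂P, ∃! σ : Equiv.Perm (Fin k),
      Matches (incr k (Φ (Z · ω) (Y ω))) (Z · ω) σ)
    (σ : Equiv.Perm (Fin k)) {C : Set (ℝ≥0 → ℝ)} (hC : MeasurableSet C) :
    (Fintype.card (Equiv.Perm (Fin k)) : ℝ≥0∞) *
      P ({ω | Matches (incr k (Φ (Z · ω) (Y ω))) (Z · ω) σ} ∩ {ω | Φ (Z · ω) (Y ω) ∈ C})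
      = P {ω | Φ (Z · ω) (Y ω) ∈ C} := by
  let D : Equiv.Perm (Fin k) → Set ((Fin k → ℝ × ℝ) × β) := fun σ ↦
    {p | Matches (incr k (Φ p.1 p.2)) p.1 σ} ∩ {p | Φ p.1 p.2 ∈ C}
  have hM : ∀ σ, MeasurableSet
      {p : (Fin k → ℝ × ℝ) × β | Matches (incr k (Φ p.1 p.2)) p.1 σ} := fun σ ↦
    (measurable_fst.prodMk hΦ) (measurableSet_matches σ)
  have hD : ∀ σ, MeasurableSet (D σ) := fun σ ↦ (hM σ).inter (hΦ hC)
  have hZY' : Measurable fun ω ↦ ((fun i ↦ Z i ω), Y ω) :=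
    (measurable_pi_iff.2 hZm).prodMk hY
  have hconst : ∀ σ σ' : Equiv.Perm (Fin k),
      P ({ω | Matches (incr k (Φ (Z · ω) (Y ω))) (Z · ω) σ'} ∩ {ω | Φ (Z · ω) (Y ω) ∈ C})
      = P ({ω | Matches (incr k (Φ (Z · ω) (Y ω))) (Z · ω) σ} ∩ {ω | Φ (Z · ω) (Y ω) ∈ C}) := by
    intro σ σ'
    -- As `σ * τ = σ'`, relabelling `Z` by `τ` turns the event for `σ'` into the event for `σ`,
    -- while the symmetric path `Φ` and the joint law stay the same.
    let τ : Equiv.Perm (Fin k) := σ⁻¹ * σ'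
    have hστ : σ * τ = σ' := by simp [τ]
    have h1 := (identDistrib_perm hY hZ hid hZY τ).measure_mem_eq (hD σ')
    refine h1.symm.trans ?_
    congr 1
    ext ω
    have e : (fun i ↦ Z (τ i) ω) = (Z · ω) ∘ τ := rfl
    simp only [D, mem_preimage, mem_inter_iff, mem_ofPred_eq, e, hsymm]
    rw [← hστ, matches_comp]
  have hE : MeasurableSet {ω | Φ (Z · ω) (Y ω) ∈ C} := hZY' (hΦ hC)
  rw [measure_eq_sum_of_ae_existsUnique
    (M := fun σ ↦ {ω | Matches (incr k (Φ (Z · ω) (Y ω))) (Z · ω) σ})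
    (fun σ ↦ (hZY' (hM σ)).nullMeasurableSet) hex hE.nullMeasurableSet]
  simp_rw [hconst σ]
  rw [Finset.sum_const, Finset.card_univ, nsmul_eq_mul]

theorem measurable_reorder {k : ℕ} (σ : Equiv.Perm (Fin k)) (I : Finset ℝ≥0) :
    Measurable fun (w : ℝ≥0 → ℝ) (t : I) ↦
      concat k (fun i s ↦ w (gridPt k (σ i) + s) - w (gridPt k (σ i))) t := by
  refine measurable_pi_iff.2 fun t ↦ Finset.measurable_fun_sum _ fun i _ ↦ ?_
  split_ifs <;> fun_prop

/-- Reordering Brownian motion by a uniform permutation independent of it yields Brownian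
motion. -/
theorem isBrownianMotionOn_reorderedBM {k : ℕ} (hk : 0 < k) {W : ℝ≥0 → Ω → ℝ}
    (hW : IsPreBrownianOn 1 W P) (hc : ∀ᵐ ω ∂P, ContinuousOn (W · ω) (Iic 1))
    {M : Equiv.Perm (Fin k) → Set Ω} (hM : ∀ σ, NullMeasurableSet (M σ) P)
    (hex : ∀ᵐ ω ∂P, ∃! σ, ω ∈ M σ)
    (hunif : ∀ σ, ∀ C : Set (ℝ≥0 → ℝ), MeasurableSet C →
      (Fintype.card (Equiv.Perm (Fin k)) : ℝ≥0∞) * P (M σ ∩ {ω | (W · ω) ∈ C})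
        = P {ω | (W · ω) ∈ C})
    {π : Ω → Equiv.Perm (Fin k)} (hπ : ∀ᵐ ω ∂P, ω ∈ M (π ω)) :
    IsBrownianMotionOn 1 (reorderedBM k W π) P where
  hasLaw I hI := by
    let Ψ : Equiv.Perm (Fin k) → (ℝ≥0 → ℝ) → I → ℝ := fun σ w t ↦
      concat k (fun i s ↦ w (gridPt k (σ i) + s) - w (gridPt k (σ i))) t
    have hlaw : ∀ σ, HasLaw (fun ω ↦ Ψ σ (W · ω)) (BrownianReal.projectiveFamily I) P := fun σ ↦ by
      have h := (hW.reorder hk σ).hasLaw I hI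
      exact h
    have hΨ : ∀ σ, Measurable (Ψ σ) := fun σ ↦ measurable_reorder σ I
    refine hasLaw_of_uniform_choice hM hex hlaw (fun σ A hA ↦ ?_) fun σ ↦ ?_
    -- The path reordered by the fixed `σ` is a measurable function of the path of `W`, so the
    -- hypothesis on path events applies to it.
    · have h1 := hunif σ (Ψ σ ⁻¹' A) (hΨ σ hA)
      exact h1
    · filter_upwards [hπ, hex] with ω h1 h2 h3
      funext t
      have h4 : reorderedBM k W π t ω = reorderedBM k W (fun _ ↦ σ) t ω :=
        reorderedBM_congr (fun _ _ ↦ rfl) (h2.unique h1 h3) t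
      exact h4
  continuousOn := by
    filter_upwards [hc] with ω hω using (continuous_reorderedBM π hω).continuousOn

end Reordering

/-! ### The marked increments. -/

section Measurability

variable {Ω : Type*}

theorem measurable_pi_family {ι : Type*} {α : ι → Type*} [∀ i, MeasurableSpace (α i)]
    {m : MeasurableSpace Ω} {f : ∀ i, Ω → α i} (hf : ∀ i, Measurable[m] (f i)) :
    Measurable[m] fun ω i ↦ f i ω :=
  measurable_pi_iff.2 hf

variable {k : ℕ} {X : ℝ≥0 → Ω → ℝ} {V : Fin k → Ω → ℝ}

/-- The grid increments of `X` together with the uniforms that break ties. -/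
noncomputable def markedIncr (k : ℕ) (X : ℝ≥0 → Ω → ℝ) (V : Fin k → Ω → ℝ) (i : Fin k) (ω : Ω) :
    ℝ × ℝ :=
  (incr k (X · ω) i, V i ω)

theorem measurable_incr {m : MeasurableSpace Ω} (hX : ∀ t, Measurable[m] (X t)) (i : Fin k) :
    Measurable[m] fun ω ↦ incr k (X · ω) i :=
  (hX _).sub (hX _)

theorem measurable_markedIncr {m : MeasurableSpace Ω} (hX : ∀ t, Measurable[m] (X t))
    (hV : ∀ i, Measurable[m] (V i)) (i : Fin k) : Measurable[m] (markedIncr k X V i) :=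
  (measurable_incr hX i).prodMk (hV i)

end Measurability

/-! ### Independence extracted from the σ-algebras of the sources. -/

section Sources

variable {Ω : Type*} {k : ℕ} {X : ℝ≥0 → Ω → ℝ}
  {U : Ω → ℝ} {V : Fin k → Ω → ℝ} {b : ℝ≥0 → Ω → ℝ} {β : Fin k → ℝ≥0 → Ω → ℝ}

theorem measurable_process {S : Set (Source k)} (hS : .process ∈ S) (t : ℝ≥0) :
    Measurable[⨆ s ∈ S, sourceSigma k X U b V β s] (X t) :=
  measurable_biSup_of_mem (m := sourceSigma k X U b V β) hS (measurable_pathSigma (mem_univ t))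

theorem measurable_endUniform {S : Set (Source k)} (hS : .endUniform ∈ S) :
    Measurable[⨆ s ∈ S, sourceSigma k X U b V β s] U :=
  measurable_biSup_of_mem (m := sourceSigma k X U b V β) hS (comap_measurable U)

theorem measurable_mainBridge {S : Set (Source k)} (hS : .mainBridge ∈ S) {t : ℝ≥0} (ht : t ≤ 1) :
    Measurable[⨆ s ∈ S, sourceSigma k X U b V β s] (b t) :=
  measurable_biSup_of_mem (m := sourceSigma k X U b V β) hS (measurable_pathSigma (mem_Iic.2 ht))

theorem measurable_gridUniform {S : Set (Source k)} {i : Fin k} (hS : .gridUniform i ∈ S) :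
    Measurable[⨆ s ∈ S, sourceSigma k X U b V β s] (V i) :=
  measurable_biSup_of_mem (m := sourceSigma k X U b V β) hS (comap_measurable (V i))

theorem measurable_gridBridge {S : Set (Source k)} {i : Fin k} (hS : .gridBridge i ∈ S) {t : ℝ≥0}
    (ht : t ≤ 1 / (k : ℝ≥0)) : Measurable[⨆ s ∈ S, sourceSigma k X U b V β s] (β i t) :=
  measurable_biSup_of_mem (m := sourceSigma k X U b V β) hS (measurable_pathSigma (mem_Iic.2 ht))

variable [mΩ : MeasurableSpace Ω] {P : Measure Ω}

theorem sourceSigma_le (hX : IsLevyProcess X P) (hU : IsStandardUniform U P)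
    (hV : ∀ i, IsStandardUniform (V i) P) (hb : IsBrownianBridgeOn 1 b P)
    (hβ : ∀ i, IsBrownianBridgeOn (1 / (k : ℝ≥0)) (β i) P) :
    ∀ s, sourceSigma k X U b V β s ≤ mΩ
  | .process => pathSigma_le fun t _ ↦ hX.measurable t
  | .endUniform => hU.1.comap_le
  | .mainBridge => pathSigma_le fun t ht ↦ hb.measurable t ht
  | .gridUniform i => (hV i).1.comap_le
  | .gridBridge i => pathSigma_le fun t ht ↦ (hβ i).measurable t ht

theorem iIndepFun_gridUniform (hindep : iIndep (sourceSigma k X U b V β) P) : iIndepFun V P := by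
  rw [iIndepFun_iff_iIndep]
  exact hindep.precomp (g := Source.gridUniform) fun i j h ↦ by cases h; rfl

theorem iIndepFun_gridBridge (hindep : iIndep (sourceSigma k X U b V β) P) :
    iIndepFun (fun i ω (t : Iic (1 / (k : ℝ≥0))) ↦ β i t ω) P := by
  rw [iIndepFun_iff_iIndep]
  refine iIndep_of_iIndep_of_le
    (hindep.precomp (g := Source.gridBridge) fun i j h ↦ by cases h; rfl) fun i ↦ ?_
  have h : Measurable[pathSigma (Iic (1 / (k : ℝ≥0))) (β i)]
      fun ω (t : Iic (1 / (k : ℝ≥0))) ↦ β i t ω :=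
    measurable_pi_family fun t ↦ measurable_pathSigma t.2
  exact h.comap_le

theorem indepFun_incr_gridUniform (hle : ∀ s, sourceSigma k X U b V β s ≤ mΩ)
    (hindep : iIndep (sourceSigma k X U b V β) P) :
    IndepFun (fun ω (i : Fin k) ↦ incr k (X · ω) i) (fun ω i ↦ V i ω) P := by
  have h1 := measurable_pi_family (measurable_incr (k := k)
    (measurable_process (X := X) (U := U) (V := V) (b := b) (β := β) (mem_singleton Source.process)))
  have h2 := measurable_pi_family fun i : Fin k ↦ measurable_gridUniform
    (S := range Source.gridUniform) (X := X) (U := U) (V := V) (b := b) (β := β) (mem_range_self i)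
  exact indepFun_of_iIndep hle hindep (by simp) h1 h2

/-- The set `T` of remaining sources is left open to cover both `(U, b)`, for the reordering, and
the bridges `β i`, for `Ŵ`. -/
theorem indepFun_markedIncr (hle : ∀ s, sourceSigma k X U b V β s ≤ mΩ)
    (hindep : iIndep (sourceSigma k X U b V β) P) {γ : Type*} [MeasurableSpace γ]
    {T : Set (Source k)} (h1 : .process ∉ T) (h2 : ∀ i, .gridUniform i ∉ T) {Y : Ω → γ}
    (hY : Measurable[⨆ s ∈ T, sourceSigma k X U b V β s] Y) :
    IndepFun (fun ω i ↦ markedIncr k X V i ω) Y P := by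
  have h := measurable_pi_family (measurable_markedIncr (k := k)
    (measurable_process (X := X) (U := U) (V := V) (b := b) (β := β)
      (mem_insert Source.process (range Source.gridUniform)))
    (fun i ↦ measurable_gridUniform (mem_insert_of_mem _ (mem_range_self i))))
  refine indepFun_of_iIndep hle hindep (disjoint_left.2 ?_) h hY
  rintro s (rfl | ⟨i, rfl⟩)
  · exact h1
  · exact h2 i

end Sources

/-! ### The coupled increments `ξ_i`, their ordering, and the process `Ŵ`. -/

section Coupling

theorem indepFun_apply {ι α β Ω : Type*} [MeasurableSpace Ω] [MeasurableSpace α]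
    [MeasurableSpace β] {P : Measure Ω} {A : ι → Ω → α} {B : ι → Ω → β}
    (h : IndepFun (fun ω i ↦ A i ω) (fun ω i ↦ B i ω) P) (i : ι) : IndepFun (A i) (B i) P :=
  h.comp (φ := fun x : ι → α ↦ x i) (ψ := fun x : ι → β ↦ x i)
    (measurable_pi_apply i) (measurable_pi_apply i)

variable {Ω : Type*} [MeasurableSpace Ω] {P : Measure Ω} {k : ℕ} {X : ℝ≥0 → Ω → ℝ}
  {V : Fin k → Ω → ℝ} {β : Fin k → ℝ≥0 → Ω → ℝ}

theorem IsStandardUniform.map_singleton {V : Ω → ℝ} (hV : IsStandardUniform V P) (x : ℝ) :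
    P.map V {x} = 0 := by
  rw [hV.2]; exact measure_singleton x

theorem incr_comonotoneBM {ω : Ω} (hβ : ∀ i, β i (1 / (k : ℝ≥0)) ω = 0) (i : Fin k) :
    incr k (comonotoneBM k P X V β · ω) i = coupledIncr k P X V i ω := by
  have h := incr_concat (fun i s ↦ β i s ω + k * s * coupledIncr k P X V i ω) i
  refine h.trans ?_
  have hk : (k : ℝ) ≠ 0 := by exact_mod_cast i.pos.ne'
  rw [hβ i]
  simp [hk]

theorem continuous_comonotoneBM {ω : Ω} (h0 : ∀ i, β i 0 ω = 0)
    (hc : ∀ i, ContinuousOn (β i · ω) (Iic (1 / (k : ℝ≥0)))) :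
    Continuous (comonotoneBM k P X V β · ω) := by
  refine continuous_concat (fun i ↦ by simp [h0]) fun i ↦ ?_
  exact (hc i).add (Continuous.continuousOn (by fun_prop))

theorem IsLevyProcess.hasLaw_incr (hX : IsLevyProcess X P) (i : Fin k) :
    HasLaw (fun ω ↦ incr k (X · ω) i) (P.map (X (1 / (k : ℝ≥0)))) P :=
  ⟨(hX.identDistrib_incr i).aemeasurable_fst, (hX.identDistrib_incr i).map_eq⟩

theorem iIndepFun_markedIncr (hX : IsLevyProcess X P) (hV : ∀ i, IsStandardUniform (V i) P)
    (hXV : IndepFun (fun ω (i : Fin k) ↦ incr k (X · ω) i) (fun ω i ↦ V i ω) P)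
    (hVi : iIndepFun V P) : iIndepFun (markedIncr k X V) P :=
  iIndepFun_prodMk (measurable_incr hX.measurable) (fun i ↦ (hV i).1) (hX.iIndepFun_incr k)
    hVi hXV

variable [IsProbabilityMeasure P]

theorem IsLevyProcess.isProbabilityMeasure_map (hX : IsLevyProcess X P) (t : ℝ≥0) :
    IsProbabilityMeasure (P.map (X t)) :=
  Measure.isProbabilityMeasure_map (hX.measurable t).aemeasurable

theorem IsLevyProcess.measurable_comonotone (hX : IsLevyProcess X P) (t : ℝ≥0) (ν : Measure ℝ) :
    Measurable fun p : ℝ × ℝ ↦ comonotone (P.map (X t)) ν p.1 p.2 := by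
  have := hX.isProbabilityMeasure_map t
  exact LevyCoupling.measurable_comonotone _ _

/-- The second coordinates alone are almost surely distinct, so ties among the increments of `X` do
no harm. -/
theorem ae_injective_markedIncr (hV : ∀ i, IsStandardUniform (V i) P) (hVi : iIndepFun V P) :
    ∀ᵐ ω ∂P, Function.Injective fun i ↦ markedIncr k X V i ω := by
  have h : ∀ᵐ ω ∂P, ∀ i j, i ≠ j → V i ω ≠ V j ω := by
    simp_rw [ae_all_iff]
    exact fun i j hij ↦ IndepFun.ae_ne (hV i).1.aemeasurable (hV j).1.aemeasurable
      (hVi.indepFun hij) (hV j).map_singleton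
  filter_upwards [h] with ω hω i j hij
  by_contra hne
  exact hω i j hne (Prod.ext_iff.1 hij).2

section

variable (hX : IsLevyProcess X P) (hV : ∀ i, IsStandardUniform (V i) P)
  (hXV : IndepFun (fun ω (i : Fin k) ↦ incr k (X · ω) i) (fun ω i ↦ V i ω) P)
include hX hV hXV

theorem identDistrib_markedIncr (i j : Fin k) :
    IdentDistrib (markedIncr k X V i) (markedIncr k X V j) P P := by
  refine IdentDistrib.prodMk ((hX.identDistrib_incr i).trans (hX.identDistrib_incr j).symm)
    ⟨(hV i).1.aemeasurable, (hV j).1.aemeasurable, by rw [(hV i).2, (hV j).2]⟩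
    (indepFun_apply hXV i) (indepFun_apply hXV j)

theorem hasLaw_coupledIncr (i : Fin k) :
    HasLaw (coupledIncr k P X V i) (gaussianReal 0 (1 / (k : ℝ≥0))) P := by
  have := hX.isProbabilityMeasure_map (1 / (k : ℝ≥0))
  exact hasLaw_comonotone (hX.hasLaw_incr i) (measurable_incr hX.measurable i) (hV i)
    (indepFun_apply hXV i) _

variable (hVi : iIndepFun V P)
include hVi

theorem iIndepFun_coupledIncr : iIndepFun (coupledIncr k P X V) P :=
  (iIndepFun_markedIncr hX hV hXV hVi).comp
    (fun _ p ↦ comonotone (P.map (X (1 / (k : ℝ≥0)))) (gaussianReal 0 (1 / (k : ℝ≥0))) p.1 p.2)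
    fun _ ↦ hX.measurable_comonotone _ _

theorem ae_injective_coupledIncr :
    ∀ᵐ ω ∂P, Function.Injective fun i ↦ coupledIncr k P X V i ω := by
  have h : ∀ᵐ ω ∂P, ∀ i j, i ≠ j → coupledIncr k P X V i ω ≠ coupledIncr k P X V j ω := by
    simp_rw [ae_all_iff]
    intro i j hij
    have hi := hasLaw_coupledIncr hX hV hXV i
    have hj := hasLaw_coupledIncr hX hV hXV j
    refine IndepFun.ae_ne hi.aemeasurable hj.aemeasurable
      ((iIndepFun_coupledIncr hX hV hXV hVi).indepFun hij) fun x ↦ ?_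
    have : NullSingletonClass (gaussianReal 0 (1 / (k : ℝ≥0))) :=
      nullSingletonClass_gaussianReal (by simpa using i.pos.ne')
    rw [hj.map_eq]
    exact measure_singleton x
  filter_upwards [h] with ω hω i j hij
  by_contra hne
  exact hω i j hne hij

/-- The comonotonically coupled increments are ordered like the marked increments of `X`. -/
theorem ae_coupledIncr_lt_iff : ∀ᵐ ω ∂P, ∀ i j : Fin k,
    coupledIncr k P X V i ω < coupledIncr k P X V j ω ↔
      incr k (X · ω) i < incr k (X · ω) j ∨
        (incr k (X · ω) i = incr k (X · ω) j ∧ V i ω < V j ω) := by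
  have := hX.isProbabilityMeasure_map (1 / (k : ℝ≥0))
  have hV' : ∀ᵐ ω ∂P, ∀ i, V i ω ∈ Icc (0 : ℝ) 1 := ae_all_iff.2 fun i ↦ (hV i).ae_mem
  have hr : ∀ᵐ ω ∂P, ∀ i : Fin k, rankTransform (P.map (X (1 / (k : ℝ≥0))))
      (incr k (X · ω) i) (V i ω) ∈ Ioo (0 : ℝ) 1 :=
    ae_all_iff.2 fun i ↦ ae_rankTransform_mem (hX.hasLaw_incr i)
      (measurable_incr hX.measurable i) (hV i) (indepFun_apply hXV i)
  filter_upwards [hV', hr, ae_injective_coupledIncr hX hV hXV hVi,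
    ae_injective_markedIncr hV hVi] with ω h1 h2 h3 h4
  -- Monotonicity of the rank and of the quantile function gives only `≤`; equality is excluded
  -- because the `ξ_i` have no ties.
  have key : ∀ i j : Fin k, (incr k (X · ω) i < incr k (X · ω) j ∨
      (incr k (X · ω) i = incr k (X · ω) j ∧ V i ω < V j ω)) →
      coupledIncr k P X V i ω < coupledIncr k P X V j ω := by
    intro i j hij
    refine lt_of_le_of_ne ?_ fun he ↦ ?_
    · exact leftInv_mono _ (h2 i).1 (rankTransform_mono _ (h1 i).2 (h1 j).1 hij) (h2 j).2
    · have : i = j := h3 he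
      subst this
      simp at hij
  -- The converse follows by trichotomy, since distinct marked increments are lexicographically
  -- comparable.
  refine fun i j ↦ ⟨fun hij ↦ ?_, key i j⟩
  rcases lt_trichotomy (incr k (X · ω) i) (incr k (X · ω) j) with h | h | h
  · exact Or.inl h
  · rcases lt_trichotomy (V i ω) (V j ω) with h' | h' | h'
    · exact Or.inr ⟨h, h'⟩
    · have : i = j := h4 (Prod.ext h h')
      subst this
      exact absurd hij (lt_irrefl _)
    · exact absurd hij (key j i (Or.inr ⟨h.symm, h'⟩)).not_gt
  · exact absurd hij (key j i (Or.inl h)).not_gt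

/-- Each `ξ_i` has variance `1/k` and is independent of `β_i`, so `β_i` with drift `k s ξ_i` is
Brownian on `[0, 1/k]`. The pairs `(Z i, β_i)` are independent over `i`, hence so are the segments.
-/
theorem isBrownianMotionOn_comonotoneBM (hk : 0 < k)
    (hβ : ∀ i, IsBrownianBridgeOn (1 / (k : ℝ≥0)) (β i) P)
    (hβi : iIndepFun (fun i ω (t : Iic (1 / (k : ℝ≥0))) ↦ β i t ω) P)
    (hZβ : IndepFun (fun ω i ↦ markedIncr k X V i ω)
      (fun ω i (t : Iic (1 / (k : ℝ≥0))) ↦ β i t ω) P) :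
    IsBrownianMotionOn 1 (comonotoneBM k P X V β) P := by
  have hT : (0 : ℝ≥0) < 1 / (k : ℝ≥0) := by
    have : (0 : ℝ≥0) < k := by exact_mod_cast hk
    positivity
  have hcm := hX.measurable_comonotone (1 / (k : ℝ≥0)) (gaussianReal 0 (1 / (k : ℝ≥0)))
  have hβm : ∀ i, Measurable fun ω (t : Iic (1 / (k : ℝ≥0))) ↦ β i t ω := fun i ↦
    measurable_pi_iff.2 fun t ↦ (hβ i).measurable t t.2
  have hS : ∀ i, IsPreBrownianOn (1 / (k : ℝ≥0))
      (fun s ω ↦ β i s ω + k * s * coupledIncr k P X V i ω) P := by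
    intro i
    have hind : IndepFun (fun ω (t : Iic (1 / (k : ℝ≥0))) ↦ β i t ω) (coupledIncr k P X V i) P :=
      hZβ.symm.comp (φ := fun x : Fin k → Iic (1 / (k : ℝ≥0)) → ℝ ↦ x i)
        (ψ := fun z : Fin k → ℝ × ℝ ↦ comonotone (P.map (X (1 / (k : ℝ≥0))))
          (gaussianReal 0 (1 / (k : ℝ≥0))) (z i).1 (z i).2)
        (measurable_pi_apply i) (hcm.comp (measurable_pi_apply i))
    refine ((hβ i).isPreBrownianOn_add hT (hasLaw_coupledIncr hX hV hXV i) hind).congr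
      fun t _ ↦ ae_of_all _ fun ω ↦ ?_
    simp only [NNReal.coe_div, NNReal.coe_one, NNReal.coe_natCast]
    rw [div_div_eq_mul_div, div_one, mul_comm (t : ℝ)]
  have hSind : iIndepFun (fun i ω (s : Iic (1 / (k : ℝ≥0))) ↦
      β i s ω + k * s * coupledIncr k P X V i ω) P := by
    have h := iIndepFun_prodMk (measurable_markedIncr hX.measurable fun i ↦ (hV i).1) hβm
      (iIndepFun_markedIncr hX hV hXV hVi) hβi hZβ
    refine h.comp (fun _ (p : (ℝ × ℝ) × (Iic (1 / (k : ℝ≥0)) → ℝ)) s ↦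
      p.2 s + k * s * comonotone (P.map (X (1 / (k : ℝ≥0))))
          (gaussianReal 0 (1 / (k : ℝ≥0))) p.1.1 p.1.2) fun _ ↦ measurable_pi_iff.2 fun s ↦ ?_
    exact ((measurable_pi_apply s).comp measurable_snd).add
      ((hcm.comp measurable_fst).const_mul _)
  have hpre := isPreBrownianOn_concat_of_iIndepFun hk hS hSind
  refine ⟨hpre.hasLaw, ?_⟩
  have h0 : ∀ᵐ ω ∂P, ∀ i, β i 0 ω = 0 :=
    ae_all_iff.2 fun i ↦ (hβ i).ae_eq_zero zero_le (by simp)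
  have hc : ∀ᵐ ω ∂P, ∀ i, ContinuousOn (β i · ω) (Iic (1 / (k : ℝ≥0))) :=
    ae_all_iff.2 fun i ↦ (hβ i).continuousOn
  filter_upwards [h0, hc] with ω h1 h2
  exact (continuous_comonotoneBM h1 h2).continuousOn

end

end Coupling

/-! ### `W'` as a symmetric function of the marked increments. -/

section EndpointPath

variable {k : ℕ}

/-- A version of `preBM` as a function of the marked increments, the uniform for the end point, and
the path of the bridge. -/
noncomputable def endpointPath (h : ℝ → ℝ → ℝ) {k : ℕ} (z : Fin k → ℝ × ℝ) (y : ℝ × (ℝ≥0 → ℝ)) (t : ℝ≥0) : ℝ :=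
  y.2 t + t * h (∑ i, (z i).1) y.1

theorem measurable_endpointPath {h : ℝ → ℝ → ℝ} (hh : Measurable (Function.uncurry h)) :
    Measurable fun p : (Fin k → ℝ × ℝ) × (ℝ × (ℝ≥0 → ℝ)) ↦ endpointPath h p.1 p.2 := by
  refine measurable_pi_iff.2 fun t ↦ ?_
  have h1 : Measurable fun p : (Fin k → ℝ × ℝ) × (ℝ × (ℝ≥0 → ℝ)) ↦
      (∑ i, (p.1 i).1, p.2.1) := by fun_prop
  have h2 : Measurable fun p : (Fin k → ℝ × ℝ) × (ℝ × (ℝ≥0 → ℝ)) ↦ p.2.2 t := by fun_prop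
  exact h2.add ((hh.comp h1).const_mul _)

/-- Only the sum of the first coordinates enters. This is the symmetry behind the uniformity of the
matching permutation. -/
theorem endpointPath_comp_perm (h : ℝ → ℝ → ℝ) (z : Fin k → ℝ × ℝ) (τ : Equiv.Perm (Fin k))
    (y : ℝ × (ℝ≥0 → ℝ)) : endpointPath h (z ∘ τ) y = endpointPath h z y := by
  funext t
  simp only [endpointPath, Function.comp_apply]
  rw [Equiv.sum_comp τ fun i ↦ (z i).1]

end EndpointPath

end LevyCoupling

/-! ### The main theorem. -/

open LevyCoupling

theorem lemma2p2 {Ω : Type*} [MeasurableSpace Ω] (P : Measure Ω) [IsProbabilityMeasure P]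
    (k : ℕ) (hk : 1 ≤ k)
    -- the Lévy process `X`
    (X : ℝ≥0 → Ω → ℝ) (hX : LevyCoupling.IsLevyProcess X P)
    (hX_four : MemLp (X 1) 4 P) (hX_mean : P[X 1] = 0) (hX_sq : ∫ ω, (X 1 ω) ^ 2 ∂P = 1)
    -- standard uniforms `U` and `V i = U_{i+1}`
    (U : Ω → ℝ) (hU : LevyCoupling.IsStandardUniform U P)
    (V : Fin k → Ω → ℝ) (hV : ∀ i, LevyCoupling.IsStandardUniform (V i) P)
    -- Brownian bridges `b` on `[0, 1]` and `β i` on `[0, 1/k]`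
    (b : ℝ≥0 → Ω → ℝ) (hb : LevyCoupling.IsBrownianBridgeOn 1 b P)
    (β : Fin k → ℝ≥0 → Ω → ℝ)
    (hβ : ∀ i, LevyCoupling.IsBrownianBridgeOn (1 / (k : ℝ≥0)) (β i) P)
    -- all of these are mutually independent
    (hindep : iIndep (LevyCoupling.sourceSigma k X U b V β) P)
    -- an arbitrary coupling of the end point of `X` with a standard normal variable
    (h : ℝ → ℝ → ℝ) (h_meas : Measurable (Function.uncurry h))
    (h_law : HasLaw (fun ω ↦ h (X 1 ω) (U ω)) (gaussianReal 0 1) P) :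
    -- the matching permutation almost surely exists and is unique
    (∀ᵐ ω ∂P, ∃! σ : Equiv.Perm (Fin k),
      LevyCoupling.IsMatching k (X · ω) (LevyCoupling.preBM h X U b · ω) (V · ω) σ) ∧
    -- `Ŵ` is a standard Brownian motion on `[0, 1]`
    LevyCoupling.IsBrownianMotionOn 1 (LevyCoupling.comonotoneBM k P X V β) P ∧
    -- for every version `π` of the matching permutation, `W` is a standard Brownian motion on
    -- `[0, 1]`, and the grid increments of `W` and `Ŵ` almost surely have the same ordering
    ∀ π : Ω → Equiv.Perm (Fin k),
      (∀ᵐ ω ∂P,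
        LevyCoupling.IsMatching k (X · ω) (LevyCoupling.preBM h X U b · ω) (V · ω) (π ω)) →
      LevyCoupling.IsBrownianMotionOn 1
        (LevyCoupling.reorderedBM k (LevyCoupling.preBM h X U b) π) P ∧
      ∀ᵐ ω ∂P, ∀ i j : Fin k,
        (LevyCoupling.incr k (LevyCoupling.reorderedBM k (LevyCoupling.preBM h X U b) π · ω) i <
          LevyCoupling.incr k (LevyCoupling.reorderedBM k (LevyCoupling.preBM h X U b) π · ω) j ↔
        LevyCoupling.incr k (LevyCoupling.comonotoneBM k P X V β · ω) i <
          LevyCoupling.incr k (LevyCoupling.comonotoneBM k P X V β · ω) j) := by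
  have hk0 : 0 < k := hk
  have hle := sourceSigma_le hX hU hV hb hβ
  have hXm := hX.measurable
  have hZm := measurable_markedIncr (k := k) hXm fun i ↦ (hV i).1
  -- Time is clipped at `1` because nothing, not even measurability, is known of `b` afterwards.
  let Y : Ω → ℝ × (ℝ≥0 → ℝ) := fun ω ↦ (U ω, fun t ↦ b (min t 1) ω)
  have hY : Measurable Y :=
    hU.1.prodMk (measurable_pi_iff.2 fun t ↦ hb.measurable _ (min_le_right t 1))
  have hZY : IndepFun (fun ω i ↦ markedIncr k X V i ω) Y P := by
    have hYm := (measurable_endUniform (S := {.endUniform, .mainBridge}) (X := X) (U := U)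
      (V := V) (b := b) (β := β) (by simp)).prodMk (measurable_pi_family fun t : ℝ≥0 ↦
        measurable_mainBridge (by simp) (min_le_right t 1))
    exact indepFun_markedIncr hle hindep (by simp) (by simp) hYm
  have hZβ : IndepFun (fun ω i ↦ markedIncr k X V i ω)
      (fun ω i (t : Iic (1 / (k : ℝ≥0))) ↦ β i t ω) P := by
    have hβm := measurable_pi_family fun i : Fin k ↦ measurable_pi_family
      fun t : Iic (1 / (k : ℝ≥0)) ↦ measurable_gridBridge (S := range Source.gridBridge) (X := X)
        (U := U) (V := V) (b := b) (β := β) (mem_range_self i) t.2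
    exact indepFun_markedIncr hle hindep (by simp) (by simp) hβm
  have hVi := iIndepFun_gridUniform hindep
  have hXV := indepFun_incr_gridUniform hle hindep
  -- Unlike `preBM`, this version is everywhere a function of the marked increments and `Y`. The two
  -- agree on `[0, 1]` when `X 0 = 0`, hence almost surely.
  let W : ℝ≥0 → Ω → ℝ := fun t ω ↦ endpointPath h (markedIncr k X V · ω) (Y ω) t
  have hWpre : ∀ᵐ ω ∂P, ∀ t ≤ 1, preBM h X U b t ω = W t ω := by
    filter_upwards [hX.zero] with ω hω t ht
    have h1 : ∑ i, (markedIncr k X V i ω).1 = X 1 ω := by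
      have h2 := sum_incr hk0 (X · ω)
      rw [hω, sub_zero] at h2
      exact h2
    simp only [W, Y, endpointPath, preBM, h1, min_eq_left ht]
  have hbξ : IndepFun (fun ω (t : Iic (1 : ℝ≥0)) ↦ b t ω) (fun ω ↦ h (X 1 ω) (U ω)) P := by
    have h1 := measurable_pi_family fun t : Iic (1 : ℝ≥0) ↦ measurable_mainBridge
      (S := {.mainBridge}) (X := X) (U := U) (V := V) (b := b) (β := β) (by simp) t.2
    have h2 := h_meas.comp ((measurable_process (S := {.process, .endUniform}) (X := X) (U := U)
      (V := V) (b := b) (β := β) (by simp) 1).prodMk (measurable_endUniform (by simp)))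
    exact indepFun_of_iIndep hle hindep (by simp) h1 h2
  have hpre : IsPreBrownianOn 1 (preBM h X U b) P :=
    (hb.isPreBrownianOn_add one_pos h_law hbξ).congr fun t _ ↦ ae_of_all _ fun ω ↦ by
      simp [preBM]
  have hW : IsPreBrownianOn 1 W P := hpre.congr fun t ht ↦ by
    filter_upwards [hWpre] with ω hω using hω t ht
  have hWc : ∀ᵐ ω ∂P, ContinuousOn (W · ω) (Iic 1) := by
    filter_upwards [hb.continuousOn, hWpre] with ω h1 h2
    refine ContinuousOn.congr (f := (preBM h X U b · ω)) ?_ fun t ht ↦ (h2 t ht).symm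
    exact h1.add (Continuous.continuousOn (by fun_prop))
  let M : Equiv.Perm (Fin k) → Set Ω := fun σ ↦
    {ω | Matches (incr k (W · ω)) (markedIncr k X V · ω) σ}
  have hM : ∀ σ, MeasurableSet (M σ) := fun σ ↦ by
    have hZ' : Measurable fun ω ↦ (fun i ↦ markedIncr k X V i ω) := measurable_pi_iff.2 hZm
    have h1 := hZ'.prodMk ((measurable_endpointPath (k := k) h_meas).comp (hZ'.prodMk hY))
    exact h1 (measurableSet_matches σ)
  have hex : ∀ᵐ ω ∂P, ∃! σ, ω ∈ M σ := by
    filter_upwards [hW.ae_injective_incr (k := k), ae_injective_markedIncr hV hVi]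
      with ω h1 h2
    exact existsUnique_matches h1 h2
  have hmatch : ∀ᵐ ω ∂P, ∀ σ, IsMatching k (X · ω) (preBM h X U b · ω) (V · ω) σ ↔ ω ∈ M σ := by
    filter_upwards [hWpre] with ω hω σ
    have h1 : incr k (preBM h X U b · ω) = incr k (W · ω) := incr_congr hω
    unfold IsMatching
    rw [h1]
    rfl
  have hunif : ∀ σ, ∀ C : Set (ℝ≥0 → ℝ), MeasurableSet C →
      (Fintype.card (Equiv.Perm (Fin k)) : ℝ≥0∞) * P (M σ ∩ {ω | (W · ω) ∈ C})
        = P {ω | (W · ω) ∈ C} := fun σ C hC ↦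
    card_mul_measure_matches hZm hY (iIndepFun_markedIncr hX hV hXV hVi)
      (identDistrib_markedIncr hX hV hXV) hZY (measurable_endpointPath h_meas)
      (endpointPath_comp_perm h) hex σ hC
  refine ⟨?_, isBrownianMotionOn_comonotoneBM hX hV hXV hVi hk0 hβ
    (iIndepFun_gridBridge hindep) hZβ, fun π hπ ↦ ⟨?_, ?_⟩⟩
  · filter_upwards [hmatch, hex] with ω h1 h2
    simpa only [h1] using h2
  · have hπM : ∀ᵐ ω ∂P, ω ∈ M (π ω) := by
      filter_upwards [hmatch, hπ] with ω h1 h2 using (h1 _).1 h2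
    have hBM := isBrownianMotionOn_reorderedBM hk0 hW hWc
      (fun σ ↦ (hM σ).nullMeasurableSet) hex hunif hπM
    have hcongr : ∀ᵐ ω ∂P, ∀ t, reorderedBM k (preBM h X U b) π t ω = reorderedBM k W π t ω := by
      filter_upwards [hWpre] with ω hω using reorderedBM_congr hω rfl
    refine ⟨fun I hI ↦ (hBM.hasLaw I hI).congr ?_, ?_⟩
    · filter_upwards [hcongr] with ω hω
      funext t
      exact hω t
    · filter_upwards [hcongr, hBM.continuousOn] with ω h1 h2
      simpa only [h1] using h2
  · have hβ0 : ∀ᵐ ω ∂P, ∀ i, β i (1 / (k : ℝ≥0)) ω = 0 :=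
      ae_all_iff.2 fun i ↦ (hβ i).ae_eq_zero le_rfl (by rw [mul_self_div_self, sub_self])
    filter_upwards [hπ, hβ0, ae_coupledIncr_lt_iff hX hV hXV hVi] with ω h1 h2 h3 i j
    rw [incr_reorderedBM, incr_reorderedBM, incr_comonotoneBM h2, incr_comonotoneBM h2, h3]
    -- `IsMatching` compares distinct indices only; on the diagonal both strict inequalities fail.
    by_cases hij : i = j
    · subst hij
      simp
    · exact h1 i j hij
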